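/- **Setting.** Let $C,A_1,\dots,A_m\in\mathbb R^{n\times n}$ be symmetric with $A_1,\dots,A_m$ linearly independent, and let $b\in\mathbb R^m$; these are the data of the semidefinite program $\max\langle C,X\rangle$ subject to $X\succeq 0$, $\langle A_i,X\rangle=b_i$ $(i\in[m])$. For $y\in\mathbb R^m$, $\eta>0$ and $M\in\mathbb R^{n\times n}$ put $$S(y)=\sum_{i=1}^m y_iA_i-C,\quad g_\eta(y)_j=\eta b_j-\mathrm{tr}[S(y)^{-1}A_j],\quad H(M)_{j,k}=\mathrm{tr}[M^{-1}A_jM^{-1}A_k],\quad H(y)=H(S(y)).$$ **The algorithm.** Let $0<\delta\le 0.1$, $0<\epsilon_N\le 0.1$, $\epsilon_S=0.01$ and $T=\left\lceil\frac{40}{\epsilon_N}\sqrt n\,\log(n/\delta)\right\rceil$. The interior point method starts from a parameter $\eta>0$ and a vector $y$, with $\widetilde S=S(y)$, and in each of the iterations $1,\dots,T$ it performs $$\eta\leftarrow\eta\Big(1+\frac{\epsilon_N}{20\sqrt n}\Big),\qquad y\leftarrow y-H(\widetilde S)^{-1}g_\eta(y),\qquad \widetilde S\leftarrow\textsc{ApproxSlackUpdate}(S(y),\widetilde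 S).$$ $\textsc{ApproxSlackUpdate}(S_{\rm new},\widetilde S)$ takes a spectral decomposition $S_{\rm new}^{-1/2}\widetilde S S_{\rm new}^{-1/2}-I=U\,\mathrm{diag}(\lambda)\,U^\top$ and a permutation $\pi$ with $|\lambda_{\pi(1)}|\ge\dots\ge|\lambda_{\pi(n)}|$ (any valid choices; put $\lambda_{\pi(j)}=0$ for $j>n$). If $|\lambda_{\pi(1)}|\le\epsilon_S$, it returns $\widetilde S$. Otherwise let $r\ge1$ be the least integer with $|\lambda_{\pi(2r)}|\le\epsilon_S$ and $|\lambda_{\pi(2r)}|\le(1-1/\log n)|\lambda_{\pi(r)}|$; let $\lambda_{\rm new}$ be $\lambda$ with the entries $\pi(1),\dots,\pi(2r)$ replaced by $0$; it returns $\widetilde S+S_{\rm new}^{1/2}\,U\,\mathrm{diag}(\lambda_{\rm new}-\lambda)\,U^\top S_{\rm new}^{1/2}$. Let $r_0=n$ and, for $1\le i\le T$, let $r_i$ be the rank of the change of $\widetilde S$ in iteration $i$. **Theorem (rank inequality).** There is a universal constant $K>0$ such that the following two statements hold. 1. Let $n\ge2$, and suppose that the method is started at some $\eta>0$ and a strictly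 dual feasible $y$ (that is, $S(y)\succ0$) close to the central path in the sense that $g_\eta(y)^\top H(y)^{-1}g_\eta(y)\le\epsilon_N^2$. Then $$\sum_{i=0}^T\sqrt{r_i}\le K\,T\log^{1.5}n .$$ 2. Let $R,L>0$ with $\|C\|_{\rm op}\le L$, and suppose $\delta\sqrt n\le\epsilon_N$. Consider the modified program of size $n+2$ with $m+1$ constraints given by $\overline A_i=\mathrm{diag}(A_i,0,\tfrac{b_i}{R}-\mathrm{tr}[A_i])$ for $i\in[m]$, $\overline A_{m+1}=\mathrm{diag}(I_n,1,0)$, $\overline b=(\tfrac1Rb,\,n+1)$, $\overline C=\mathrm{diag}(\tfrac{\delta}{L}C,0,-1)$. Suppose that the method is run on this program (so with $n+2$ in place of $n$ everywhere, in particular in $T$ and $r_0$) from $\overline y=(0,\dots,0,1)$ and $\eta=1$. Then $$\sum_{i=0}^T\sqrt{r_i}\le K\,T\log^{1.5}(n+2) .$$ -/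

import Mathlib

open scoped Matrix MatrixOrder

noncomputable section

/-- Data of a semidefinite program with an `n × n` matrix variable and `m` constraints:
maximise `⟨C, X⟩` subject to `X ⪰ 0` and `⟨A i, X⟩ = b i` for all `i`. -/
structure SDPData (n m : ℕ) where
  C : Matrix (Fin n) (Fin n) ℝ
  A : Fin m → Matrix (Fin n) (Fin n) ℝ
  b : Fin m → ℝ
  C_symm : C.IsSymm
  A_symm : ∀ i, (A i).IsSymm

namespace SDPData

variable {n m : ℕ}

/-- There are no redundant constraints: the constraint matrices are linearly independent. -/
def NoRedundantConstraints (P : SDPData n m) : Prop := LinearIndependent ℝ P.A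

/-- The slack matrix `S(y) = ∑ i, y i • A i - C` of the dual program
`min b ⬝ y` subject to `S(y) ⪰ 0`. -/
def slack (P : SDPData n m) (y : Fin m → ℝ) : Matrix (Fin n) (Fin n) ℝ :=
  ∑ i, y i • P.A i - P.C

/-- The `m × m` matrix with entries `tr (M⁻¹ A j M⁻¹ A k)`. For `M = S(y)` it is the Hessian `H(y)`
of the log barrier; for `M` an approximate slack matrix it is the approximate Hessian. -/
def hessian (P : SDPData n m) (M : Matrix (Fin n) (Fin n) ℝ) : Matrix (Fin m) (Fin m) ℝ :=
  Matrix.of fun j k => (M⁻¹ * P.A j * M⁻¹ * P.A k).trace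

/-- The gradient at `y` of the penalised objective `η * (b ⬝ y) - log det S(y)`. -/
def gradient (P : SDPData n m) (η : ℝ) (y : Fin m → ℝ) : Fin m → ℝ :=
  fun j => η * P.b j - ((P.slack y)⁻¹ * P.A j).trace

/-- `y` is strictly dual feasible, and it is close to the dual central path at `η`: the Newton step
at `y` has size at most `εN`, that is, `g_η(y)ᵀ H(y)⁻¹ g_η(y) ≤ εN ^ 2`. -/
def NearCentralPath (P : SDPData n m) (εN η : ℝ) (y : Fin m → ℝ) : Prop :=
  (P.slack y).PosDef ∧
    P.gradient η y ⬝ᵥ ((P.hessian (P.slack y))⁻¹ *ᵥ P.gradient η y) ≤ εN ^ 2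

end SDPData

/-- The spectral approximation constant `ε_S`. -/
def epsS : ℝ := 1 / 100

/-- `|λ_{π(j)}|` for a one-based position `j`, with the convention that it is `0` when `j` is not
one of the positions `1, …, n`. -/
def absEig {n : ℕ} (lam : Fin n → ℝ) (π : Equiv.Perm (Fin n)) (j : ℕ) : ℝ :=
  if h : 1 ≤ j ∧ j ≤ n then |lam (π ⟨j - 1, by omega⟩)| else 0

/-- The guard of the while loop that determines `r`. -/
def LoopGuard {n : ℕ} (lam : Fin n → ℝ) (π : Equiv.Perm (Fin n)) (r : ℕ) : Prop :=
  epsS < absEig lam π (2 * r) ∨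
    (1 - 1 / Real.log n) * absEig lam π r < absEig lam π (2 * r)

/-- The vector `λ_new`: the entries of `λ` at the sorted positions `1, …, 2r` are set to `0`. -/
def newEig {n : ℕ} (lam : Fin n → ℝ) (π : Equiv.Perm (Fin n)) (r : ℕ) : Fin n → ℝ :=
  fun k => if (π.symm k : ℕ) + 1 ≤ 2 * r then 0 else lam k

/-- `StNew` is a possible output of the procedure `ApproxSlackUpdate` on the input `(Snew, St)`.
The spectral decomposition `Z_mid = U diag(lam) Uᵀ` and the sorting permutation `π` may be any valid
ones. The while loop starts at `r = 1` and increments `r` as long as its guard holds, so it ends at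
the least `r ≥ 1` at which the guard fails. -/
def IsApproxSlackUpdate {n : ℕ} (Snew St StNew : Matrix (Fin n) (Fin n) ℝ) : Prop :=
  ∃ U ∈ Matrix.orthogonalGroup (Fin n) ℝ, ∃ (lam : Fin n → ℝ) (π : Equiv.Perm (Fin n)),
    (CFC.sqrt Snew)⁻¹ * St * (CFC.sqrt Snew)⁻¹ - 1 = U * Matrix.diagonal lam * Uᵀ ∧
    Antitone (fun i : Fin n => |lam (π i)|) ∧
    ((absEig lam π 1 ≤ epsS ∧ StNew = St) ∨
      (epsS < absEig lam π 1 ∧ ∃ r : ℕ, IsLeast {r : ℕ | 1 ≤ r ∧ ¬ LoopGuard lam π r} r ∧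
        StNew = St + CFC.sqrt Snew * U * Matrix.diagonal (newEig lam π r - lam) * Uᵀ
          * CFC.sqrt Snew))

/-- The variables that the interior point method carries from one iteration to the next: the
parameter `η`, the dual solution `y` and the approximate slack matrix. The true slack matrix is
always `S(y)`. -/
structure IPMState (n m : ℕ) where
  η : ℝ
  y : Fin m → ℝ
  St : Matrix (Fin n) (Fin n) ℝ

/-- `s'` is a possible result of one iteration of the interior point method from `s`: increase `η`,
take the Newton step with the approximate Hessian, update the approximate slack matrix. -/
structure IPMStep {n m : ℕ} (P : SDPData n m) (εN : ℝ) (s s' : IPMState n m) : Prop where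
  eta_new : s'.η = s.η * (1 + εN / (20 * √(n : ℝ)))
  y_new : s'.y = s.y - (P.hessian s.St)⁻¹ *ᵥ P.gradient s'.η s.y
  St_new : IsApproxSlackUpdate (P.slack s'.y) s.St s'.St

/-- The number `T` of iterations, `(40 / εN) √n log (n / δ)` rounded up. -/
def numIterations (n : ℕ) (δ εN : ℝ) : ℕ :=
  ⌈40 / εN * √(n : ℝ) * Real.log (n / δ)⌉₊

/-- `s 0, …, s T` are the successive states in a run of the interior point method that starts at
the parameter `η₀` and the dual solution `y₀`, with the approximate slack matrix equal to the
true one. -/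
structure IsIPMRun {n m : ℕ} (P : SDPData n m) (δ εN η₀ : ℝ) (y₀ : Fin m → ℝ)
    (s : ℕ → IPMState n m) : Prop where
  eta_init : (s 0).η = η₀
  y_init : (s 0).y = y₀
  St_init : (s 0).St = P.slack y₀
  step : ∀ t < numIterations n δ εN, IPMStep P εN (s t) (s (t + 1))

/-- `r_0 = n`, and for `i ≥ 1`, `r_i` is the rank of the update to the approximate slack matrix in
iteration `i`. -/
def updateRank {n m : ℕ} (s : ℕ → IPMState n m) : ℕ → ℕ
  | 0 => n
  | i + 1 => ((s (i + 1)).St - (s i).St).rank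

/-- The block diagonal matrix `diag(M, u, v)` of size `n + 2`. -/
def blockDiag {n : ℕ} (M : Matrix (Fin n) (Fin n) ℝ) (u v : ℝ) :
    Matrix (Fin (n + 2)) (Fin (n + 2)) ℝ :=
  Matrix.reindex finSumFinEquiv finSumFinEquiv
    (Matrix.fromBlocks M 0 0 (Matrix.diagonal ![u, v]))

lemma blockDiag_isSymm {n : ℕ} {M : Matrix (Fin n) (Fin n) ℝ} (hM : M.IsSymm) (u v : ℝ) :
    (blockDiag M u v).IsSymm := by
  unfold blockDiag Matrix.IsSymm
  rw [Matrix.transpose_reindex, Matrix.fromBlocks_transpose, hM.eq]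
  simp

/-- The modified semidefinite program, of size `n + 2` and with `m + 1` constraints, on which the
interior point method is run in order to solve `P`. -/
def SDPData.modified {n m : ℕ} (P : SDPData n m) (δ R L : ℝ) : SDPData (n + 2) (m + 1) where
  C := blockDiag ((δ / L) • P.C) 0 (-1)
  A := Fin.snoc (α := fun _ => Matrix (Fin (n + 2)) (Fin (n + 2)) ℝ)
    (fun i => blockDiag (P.A i) 0 (P.b i / R - (P.A i).trace)) (blockDiag 1 1 0)
  b := Fin.snoc (α := fun _ => ℝ) (fun i => P.b i / R) (n + 1)
  C_symm := blockDiag_isSymm (P.C_symm.smul _) _ _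
  A_symm := by
    intro i
    refine Fin.lastCases ?_ (fun j => ?_) i
    · rw [Fin.snoc_last]; exact blockDiag_isSymm Matrix.isSymm_one _ _
    · rw [Fin.snoc_castSucc]; exact blockDiag_isSymm (P.A_symm j) _ _

/-- The initial dual solution `(0, …, 0, 1)` of the modified program. -/
def modifiedStart (m : ℕ) : Fin (m + 1) → ℝ := Fin.snoc (α := fun _ => ℝ) (fun _ => 0) 1

end

/-!
Every quantity of the method is invariant under simultaneous congruence of all the matrices, so
each iteration may be analysed after taking its slack matrix to the identity. Measure the error
of the approximate slack matrix by the potential `∑ j, |λ_(j)| / √j`, where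
`|λ_(1)| ≥ |λ_(2)| ≥ ⋯` are the eigenvalues of the error in these coordinates: the Lorentz norm of
the spectrum with weights `1 / √j`.

A Newton step moves the slack matrix by a constant in Frobenius norm. The diagonal of an orthogonal
conjugate is the image of the spectrum under a doubly stochastic matrix, so the Lorentz norm
grows by at most the sorted inner product of the weights with the movement; by Cauchy–Schwarz and
`∑ j, 1 / j ≤ 1 + log n` a step raises the potential by `O(√(log n))`. In an update with parameter
`r` every doubling of the position below `r` costs `|λ|` at most a factor `1 - 1 / log n`, so
`|λ_(r)|` is at least a constant, while `|λ_(2r)| ≤ (1 - 1 / log n) |λ_(r)|`: the `r` largest errors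
all drop by `Ω(1 / log n)`, and the potential drops by `Ω(√r / log n)`. The potential starts at `0`
and stays nonnegative, so telescoping gives `∑ √r_i = O(T (log n)^(3/2))`.
-/

noncomputable section

section Frobenius

open scoped Matrix.Norms.Frobenius

variable {ι κ : Type*} [Fintype ι] [Fintype κ]

lemma frobenius_sq_eq_sum (X : Matrix ι κ ℝ) : ‖X‖ ^ 2 = ∑ i, ∑ j, X i j ^ 2 := by
  have h : 0 ≤ ∑ i, ∑ j, X i j ^ 2 := by positivity
  simp only [Matrix.frobenius_norm_def, Real.norm_eq_abs, Real.rpow_two, sq_abs,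
    ← Real.sqrt_eq_rpow, Real.sq_sqrt h]

lemma frobenius_sq_eq_trace (X : Matrix ι κ ℝ) : ‖X‖ ^ 2 = (Xᵀ * X).trace := by
  rw [frobenius_sq_eq_sum, Finset.sum_comm]
  simp only [Matrix.trace, Matrix.diag, Matrix.mul_apply, Matrix.transpose_apply, sq]

lemma abs_trace_mul_le (X : Matrix ι κ ℝ) (Y : Matrix κ ι ℝ) : |(X * Y).trace| ≤ ‖X‖ * ‖Y‖ := by
  have h := Finset.sum_mul_sq_le_sq_mul_sq (Finset.univ : Finset (ι × κ))
    (fun p => X p.1 p.2) (fun p => Yᵀ p.1 p.2)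
  simp only [Fintype.sum_prod_type, ← frobenius_sq_eq_sum, Matrix.frobenius_norm_transpose] at h
  refine abs_le_of_sq_le_sq ?_ (by positivity)
  simpa only [Matrix.trace, Matrix.diag, Matrix.mul_apply, Matrix.transpose_apply, mul_pow] using h

lemma frobenius_le_of_abs_le {X Y : Matrix ι κ ℝ} {c : ℝ} (hc : 0 ≤ c)
    (h : ∀ i j, |X i j| ≤ c * |Y i j|) : ‖X‖ ≤ c * ‖Y‖ := by
  refine le_of_sq_le_sq ?_ (by positivity)
  simp only [mul_pow, frobenius_sq_eq_sum, Finset.mul_sum]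
  refine Finset.sum_le_sum fun i _ => Finset.sum_le_sum fun j _ => ?_
  have := pow_le_pow_left₀ (abs_nonneg _) (h i j) 2
  rwa [mul_pow, sq_abs, sq_abs] at this

lemma norm_one_sub_le_of_mul_eq_one {R : Type*} [SeminormedRing R] {a g : R} (hag : a * g = 1)
    (ha : ‖a - 1‖ < 1) : ‖1 - g‖ ≤ ‖a - 1‖ / (1 - ‖a - 1‖) := by
  have hg : 1 - g = (a - 1) - (a - 1) * (1 - g) := by
    rw [show (a - 1) - (a - 1) * (1 - g) = a * g - g by noncomm_ring, hag]
  have h : ‖1 - g‖ ≤ ‖a - 1‖ + ‖a - 1‖ * ‖1 - g‖ := by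
    conv_lhs => rw [hg]
    exact (norm_sub_le _ _).trans (by gcongr; exact norm_mul_le _ _)
  rw [le_div_iff₀ (by linarith)]
  linarith

variable [DecidableEq ι]

lemma frobenius_one : ‖(1 : Matrix ι ι ℝ)‖ = √(Fintype.card ι) := by
  simpa using congrArg NNReal.toReal (Matrix.frobenius_nnnorm_one (n := ι) (α := ℝ))

lemma frobenius_mul_mul_transpose_le (B : Matrix κ ι ℝ) (M : Matrix ι ι ℝ) :
    ‖B * M * Bᵀ‖ ≤ (1 + ‖Bᵀ * B - 1‖) * ‖M‖ := by
  set N := Bᵀ * B with hN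
  have hleft : ‖N * M‖ ≤ (1 + ‖N - 1‖) * ‖M‖ := by
    have h : N * M = M + (N - 1) * M := by noncomm_ring
    rw [h, add_mul, one_mul]
    exact (norm_add_le _ _).trans (by gcongr; exact norm_mul_le _ _)
  have hright : ‖M * N‖ ≤ (1 + ‖N - 1‖) * ‖M‖ := by
    have h : M * N = M + M * (N - 1) := by noncomm_ring
    rw [h, add_mul, one_mul, mul_comm ‖N - 1‖]
    exact (norm_add_le _ _).trans (by gcongr; exact norm_mul_le _ _)
  have hsq : ‖B * M * Bᵀ‖ ^ 2 = ((N * M)ᵀ * (M * N)).trace := by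
    rw [frobenius_sq_eq_trace]
    simp only [hN, Matrix.transpose_mul, Matrix.transpose_transpose, Matrix.mul_assoc]
    rw [Matrix.trace_mul_comm]
    simp only [Matrix.mul_assoc]
  refine le_of_sq_le_sq ?_ (by positivity)
  calc ‖B * M * Bᵀ‖ ^ 2 ≤ ‖(N * M)ᵀ‖ * ‖M * N‖ :=
        hsq.le.trans ((le_abs_self _).trans (abs_trace_mul_le _ _))
    _ ≤ ((1 + ‖N - 1‖) * ‖M‖) * ((1 + ‖N - 1‖) * ‖M‖) := by
        rw [Matrix.frobenius_norm_transpose]; gcongr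
    _ = ((1 + ‖N - 1‖) * ‖M‖) ^ 2 := (sq _).symm

lemma frobenius_transpose_mul_self_sub_one (B : Matrix ι ι ℝ) :
    ‖Bᵀ * B - 1‖ = ‖B * Bᵀ - 1‖ := by
  have hsq : (Bᵀ * B * (Bᵀ * B)).trace = (B * Bᵀ * (B * Bᵀ)).trace := by
    rw [Matrix.mul_assoc, Matrix.trace_mul_comm]
    simp only [Matrix.mul_assoc]
  refine (sq_eq_sq₀ (norm_nonneg _) (norm_nonneg _)).mp ?_
  simp only [frobenius_sq_eq_trace, Matrix.transpose_sub, Matrix.transpose_mul,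
    Matrix.transpose_transpose, Matrix.transpose_one, sub_mul, mul_sub, one_mul, mul_one,
    Matrix.trace_sub, hsq, Matrix.trace_mul_comm Bᵀ B]

lemma frobenius_sub_diagonal_mul_mul_le {d : ι → ℝ} {c : ℝ} (hc : 0 ≤ c)
    (h : ∀ i j, |1 - d i * d j| ≤ c) (X : Matrix ι ι ℝ) :
    ‖X - Matrix.diagonal d * X * Matrix.diagonal d‖ ≤ c * ‖X‖ := by
  refine frobenius_le_of_abs_le hc fun i j => ?_
  rw [Matrix.sub_apply, Matrix.mul_diagonal, Matrix.diagonal_mul,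
    show X i j - d i * X i j * d j = (1 - d i * d j) * X i j by ring, abs_mul]
  exact mul_le_mul_of_nonneg_right (h i j) (abs_nonneg _)

lemma sq_mul_frobenius_sq_le_trace {d : ι → ℝ} {c : ℝ} (hc : 0 ≤ c) (h : ∀ i, c ≤ d i)
    {X : Matrix ι ι ℝ} (hX : X.IsSymm) :
    c ^ 2 * ‖X‖ ^ 2 ≤ (Matrix.diagonal d * X * Matrix.diagonal d * X).trace := by
  simp only [frobenius_sq_eq_sum, Finset.mul_sum, Matrix.trace, Matrix.diag,
    Matrix.mul_apply (M := _ * _ * _), Matrix.mul_diagonal, Matrix.diagonal_mul]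
  refine Finset.sum_le_sum fun i _ => Finset.sum_le_sum fun j _ => ?_
  rw [← hX.apply i j, show d i * X j i * d j * X j i = d i * d j * X j i ^ 2 by ring, sq c]
  gcongr
  exacts [hc.trans (h i), h i, h j]

lemma posDef_of_frobenius_sub_one_lt {M : Matrix ι ι ℝ} (hM : M.IsSymm) (h : ‖M - 1‖ < 1) :
    M.PosDef := by
  refine Matrix.posDef_iff_dotProduct_mulVec.mpr
    ⟨by rwa [Matrix.IsHermitian, Matrix.conjTranspose_eq_transpose_of_trivial], fun z hz => ?_⟩
  have hz_pos : 0 < z ⬝ᵥ z := by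
    simpa only [star_trivial] using Matrix.dotProduct_star_self_pos_iff.mpr hz
  have hnorm : ‖Matrix.vecMulVec z z‖ = z ⬝ᵥ z := by
    rw [← sq_eq_sq₀ (norm_nonneg _) hz_pos.le, frobenius_sq_eq_trace, Matrix.transpose_vecMulVec,
      Matrix.vecMulVec_mul_vecMulVec, Matrix.trace_vecMulVec, dotProduct_smul, smul_eq_mul, sq]
  have hquad : z ⬝ᵥ (M *ᵥ z) = z ⬝ᵥ z + ((M - 1) * Matrix.vecMulVec z z).trace := by
    rw [Matrix.mul_vecMulVec, Matrix.trace_vecMulVec, Matrix.sub_mulVec, Matrix.one_mulVec,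
      sub_dotProduct, dotProduct_comm (M *ᵥ z)]
    ring
  have hpert : |((M - 1) * Matrix.vecMulVec z z).trace| < z ⬝ᵥ z :=
    (abs_trace_mul_le _ _).trans_lt (by rw [hnorm]; nlinarith)
  rw [star_trivial, hquad]
  linarith [neg_abs_le ((M - 1) * Matrix.vecMulVec z z).trace]

end Frobenius

section Congruence

variable {ι R : Type*} [Fintype ι] [DecidableEq ι] [CommRing R] {T S M : Matrix ι ι R}

lemma isUnit_of_whitens (hT : Tᵀ * S * T = 1) : IsUnit T :=
  (Matrix.isUnit_iff_isUnit_det T).mpr (Matrix.isUnit_det_of_left_inverse hT)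

lemma inv_eq_congr (hT : IsUnit T) : M⁻¹ = T * (Tᵀ * M * T)⁻¹ * Tᵀ := by
  have hdet := (Matrix.isUnit_iff_isUnit_det T).mp hT
  have hdet' : IsUnit Tᵀ.det := by rwa [Matrix.det_transpose]
  rw [Matrix.mul_inv_rev, Matrix.mul_inv_rev, Matrix.mul_nonsing_inv_cancel_left _ _ hdet,
    Matrix.nonsing_inv_mul_cancel_right _ _ hdet']

lemma trace_inv_congr (hT : IsUnit T) (X : Matrix ι ι R) :
    ((Tᵀ * M * T)⁻¹ * (Tᵀ * X * T)).trace = (M⁻¹ * X).trace := by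
  rw [inv_eq_congr (M := M) hT, ← Matrix.mul_assoc, Matrix.trace_mul_comm]
  simp only [Matrix.mul_assoc]

lemma trace_inv_congr_mul (hT : IsUnit T) (X Y : Matrix ι ι R) :
    ((Tᵀ * M * T)⁻¹ * (Tᵀ * X * T) * (Tᵀ * M * T)⁻¹ * (Tᵀ * Y * T)).trace =
      (M⁻¹ * X * M⁻¹ * Y).trace := by
  rw [inv_eq_congr (M := M) hT, ← Matrix.mul_assoc, Matrix.trace_mul_comm]
  simp only [Matrix.mul_assoc]

lemma inv_congr_inv (hT : IsUnit T) (X : Matrix ι ι R) : (T⁻¹)ᵀ * (Tᵀ * X * T) * T⁻¹ = X := by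
  have hdet := (Matrix.isUnit_iff_isUnit_det T).mp hT
  have hdet' : IsUnit Tᵀ.det := by rwa [Matrix.det_transpose]
  rw [Matrix.transpose_nonsing_inv, Matrix.mul_assoc Tᵀ,
    Matrix.nonsing_inv_mul_cancel_left _ _ hdet', Matrix.mul_nonsing_inv_cancel_right _ _ hdet]

lemma congr_eq_zero_iff (hT : IsUnit T) {X : Matrix ι ι R} : Tᵀ * X * T = 0 ↔ X = 0 := by
  refine ⟨fun h => ?_, fun h => by rw [h, mul_zero, zero_mul]⟩
  rw [← inv_congr_inv hT X, h, mul_zero, zero_mul]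

lemma inv_transpose_mul_inv_of_whitens (hT : Tᵀ * S * T = 1) : (T⁻¹)ᵀ * T⁻¹ = S := by
  simpa only [hT, mul_one] using inv_congr_inv (isUnit_of_whitens hT) S

end Congruence

section Sqrt

variable {ι : Type*} [Fintype ι] [DecidableEq ι] {S : Matrix ι ι ℝ}

lemma isSymm_sqrt (S : Matrix ι ι ℝ) : (CFC.sqrt S).IsSymm := by
  simpa only [Matrix.IsSymm, Matrix.IsHermitian, Matrix.conjTranspose_eq_transpose_of_trivial]
    using (Matrix.nonneg_iff_posSemidef.mp (CFC.sqrt_nonneg S)).isHermitian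

lemma isUnit_det_sqrt (hS : S.PosDef) : IsUnit (CFC.sqrt S).det := by
  have h := (Matrix.isUnit_iff_isUnit_det _).mp hS.isUnit
  rw [← CFC.sqrt_mul_sqrt_self S hS.posSemidef.nonneg, Matrix.det_mul] at h
  exact isUnit_of_mul_isUnit_left h

lemma whitens_inv_sqrt (hS : S.PosDef) : ((CFC.sqrt S)⁻¹)ᵀ * S * (CFC.sqrt S)⁻¹ = 1 := by
  have hdet := isUnit_det_sqrt hS
  nth_rewrite 2 [← CFC.sqrt_mul_sqrt_self S hS.posSemidef.nonneg]
  rw [Matrix.transpose_nonsing_inv, isSymm_sqrt S, Matrix.nonsing_inv_mul_cancel_left _ _ hdet,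
    Matrix.mul_nonsing_inv _ hdet]

end Sqrt

namespace SDPData

variable {n m : ℕ} {P : SDPData n m} {T M : Matrix (Fin n) (Fin n) ℝ}

/-- The linear part `v ↦ ∑ i, v i • A i` of the slack map. -/
def comb (P : SDPData n m) : (Fin m → ℝ) →ₗ[ℝ] Matrix (Fin n) (Fin n) ℝ :=
  Fintype.linearCombination ℝ P.A

lemma comb_apply (P : SDPData n m) (v : Fin m → ℝ) : P.comb v = ∑ i, v i • P.A i :=
  Fintype.linearCombination_apply ℝ P.A v

lemma isSymm_comb (P : SDPData n m) (v : Fin m → ℝ) : (P.comb v).IsSymm := by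
  simp only [comb_apply, Matrix.IsSymm, Matrix.transpose_sum, Matrix.transpose_smul,
    (P.A_symm _).eq]

lemma slack_eq_comb_sub (P : SDPData n m) (y : Fin m → ℝ) : P.slack y = P.comb y - P.C := by
  rw [slack, comb_apply]

lemma isSymm_slack (P : SDPData n m) (y : Fin m → ℝ) : (P.slack y).IsSymm := by
  rw [slack_eq_comb_sub]
  exact (P.isSymm_comb y).sub P.C_symm

lemma slack_sub (P : SDPData n m) (y x : Fin m → ℝ) : P.slack (y - x) = P.slack y - P.comb x := by
  simp only [slack_eq_comb_sub, map_sub]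
  abel

lemma noRedundantConstraints_iff_injective :
    P.NoRedundantConstraints ↔ Function.Injective P.comb :=
  linearIndependent_iff_injective_fintypeLinearCombination

lemma trace_mul_comb (P : SDPData n m) (M : Matrix (Fin n) (Fin n) ℝ) (v : Fin m → ℝ) :
    (M * P.comb v).trace = ∑ i, v i * (M * P.A i).trace := by
  simp only [comb_apply, Matrix.mul_sum, Matrix.mul_smul, Matrix.trace_sum, Matrix.trace_smul,
    smul_eq_mul]

lemma gradient_dotProduct (P : SDPData n m) (η : ℝ) (y v : Fin m → ℝ) :
    P.gradient η y ⬝ᵥ v = η * (P.b ⬝ᵥ v) - ((P.slack y)⁻¹ * P.comb v).trace := by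
  simp only [trace_mul_comb, gradient, dotProduct, Finset.mul_sum, ← Finset.sum_sub_distrib]
  exact Finset.sum_congr rfl fun _ _ => by ring

lemma dotProduct_hessian_mulVec (P : SDPData n m) (M : Matrix (Fin n) (Fin n) ℝ)
    (u v : Fin m → ℝ) :
    u ⬝ᵥ (P.hessian M *ᵥ v) = (M⁻¹ * P.comb u * M⁻¹ * P.comb v).trace := by
  have hswap (X Y : Matrix (Fin n) (Fin n) ℝ) :
      (M⁻¹ * X * M⁻¹ * Y).trace = (M⁻¹ * Y * M⁻¹ * X).trace := by
    rw [Matrix.mul_assoc (M⁻¹ * X), Matrix.trace_mul_comm, ← Matrix.mul_assoc]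
  rw [hswap, trace_mul_comb, dotProduct]
  refine Finset.sum_congr rfl fun j _ => ?_
  rw [hswap, trace_mul_comb, Matrix.mulVec, dotProduct_comm]
  rfl

/-- The program in the coordinates `M ↦ Tᵀ M T` of the matrix space. All quantities of the interior
point method are invariant under this change of coordinates. -/
def congr (T : Matrix (Fin n) (Fin n) ℝ) (P : SDPData n m) : SDPData n m where
  C := Tᵀ * P.C * T
  A i := Tᵀ * P.A i * T
  b := P.b
  C_symm := by
    simp only [Matrix.IsSymm, Matrix.transpose_mul, Matrix.transpose_transpose, P.C_symm.eq,
      Matrix.mul_assoc]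
  A_symm i := by
    simp only [Matrix.IsSymm, Matrix.transpose_mul, Matrix.transpose_transpose, (P.A_symm i).eq,
      Matrix.mul_assoc]

lemma comb_congr (v : Fin m → ℝ) : (P.congr T).comb v = Tᵀ * P.comb v * T := by
  simp only [comb_apply, congr, Matrix.mul_sum, Matrix.sum_mul, Matrix.mul_smul, Matrix.smul_mul]

lemma slack_congr (y : Fin m → ℝ) : (P.congr T).slack y = Tᵀ * P.slack y * T := by
  rw [slack_eq_comb_sub, slack_eq_comb_sub, comb_congr, mul_sub, sub_mul, congr]

lemma gradient_congr (hT : IsUnit T) (η : ℝ) (y : Fin m → ℝ) :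
    (P.congr T).gradient η y = P.gradient η y := by
  funext j
  rw [gradient, gradient, slack_congr]
  exact congrArg (η * P.b j - ·) (trace_inv_congr hT _)

lemma hessian_congr (hT : IsUnit T) (M : Matrix (Fin n) (Fin n) ℝ) :
    (P.congr T).hessian (Tᵀ * M * T) = P.hessian M :=
  Matrix.ext fun _ _ => trace_inv_congr_mul hT _ _

lemma NoRedundantConstraints.congr (hP : P.NoRedundantConstraints) (hT : IsUnit T) :
    (P.congr T).NoRedundantConstraints := by
  rw [noRedundantConstraints_iff_injective, injective_iff_map_eq_zero] at hP ⊢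
  intro v hv
  rw [comb_congr, congr_eq_zero_iff hT] at hv
  exact hP v hv

lemma nearCentralPath_congr_iff (hT : IsUnit T) {εN η : ℝ} {y : Fin m → ℝ} :
    (P.congr T).NearCentralPath εN η y ↔ P.NearCentralPath εN η y := by
  have hpos : (Tᵀ * P.slack y * T).PosDef ↔ (P.slack y).PosDef := by
    simpa only [Matrix.star_eq_conjTranspose, Matrix.conjTranspose_eq_transpose_of_trivial] using
      Matrix.IsUnit.posDef_star_left_conjugate_iff hT
  rw [NearCentralPath, NearCentralPath, slack_congr, hpos, gradient_congr hT, hessian_congr hT]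

end SDPData

section HessianNorm

open scoped Matrix.Norms.Frobenius

namespace SDPData

variable {n m : ℕ} {P : SDPData n m} {M : Matrix (Fin n) (Fin n) ℝ} {d : Fin n → ℝ} {c : ℝ}

lemma sq_mul_frobenius_sq_le_hessian (hM : M⁻¹ = Matrix.diagonal d) (hc : 0 ≤ c)
    (hd : ∀ i, c ≤ d i) (v : Fin m → ℝ) :
    c ^ 2 * ‖P.comb v‖ ^ 2 ≤ v ⬝ᵥ (P.hessian M *ᵥ v) := by
  rw [dotProduct_hessian_mulVec, hM]
  exact sq_mul_frobenius_sq_le_trace hc hd (P.isSymm_comb v)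

lemma hessian_mulVec_inv_mulVec (hP : P.NoRedundantConstraints) (hM : M⁻¹ = Matrix.diagonal d)
    (hc : 0 < c) (hd : ∀ i, c ≤ d i) (g : Fin m → ℝ) :
    P.hessian M *ᵥ ((P.hessian M)⁻¹ *ᵥ g) = g := by
  have hunit : IsUnit (P.hessian M) := by
    rw [← Matrix.mulVec_injective_iff_isUnit]
    refine (injective_iff_map_eq_zero (P.hessian M).mulVecLin).mpr fun v hv => ?_
    have h := sq_mul_frobenius_sq_le_hessian (P := P) hM hc.le hd v
    rw [Matrix.mulVecLin_apply] at hv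
    rw [hv, dotProduct_zero, ← mul_pow] at h
    have hcomb : P.comb v = 0 := by
      simpa [hc.ne'] using pow_eq_zero_iff two_ne_zero |>.mp (h.antisymm (sq_nonneg _))
    exact (injective_iff_map_eq_zero P.comb).mp
      (noRedundantConstraints_iff_injective.mp hP) v hcomb
  rw [Matrix.mulVec_mulVec, Matrix.mul_nonsing_inv _ ((Matrix.isUnit_iff_isUnit_det _).mp hunit),
    Matrix.one_mulVec]

lemma nearCentralPath_iff_of_slack_eq_one (hP : P.NoRedundantConstraints) {ε η : ℝ} (hε : 0 ≤ ε)
    {y : Fin m → ℝ} (hy : P.slack y = 1) :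
    P.NearCentralPath ε η y ↔ ∀ v, |P.gradient η y ⬝ᵥ v| ≤ ε * ‖P.comb v‖ := by
  set g := P.gradient η y
  set x := (P.hessian 1)⁻¹ *ᵥ g
  have hx : P.hessian 1 *ᵥ x = g :=
    hessian_mulVec_inv_mulVec (d := 1) hP (by simp) one_pos (fun _ => le_rfl) g
  have hg (v : Fin m → ℝ) : g ⬝ᵥ v = (P.comb x * P.comb v).trace := by
    rw [← hx, dotProduct_comm, dotProduct_hessian_mulVec, inv_one, one_mul, mul_one,
      Matrix.trace_mul_comm]
  have hgx : g ⬝ᵥ x = ‖P.comb x‖ ^ 2 := by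
    rw [hg, frobenius_sq_eq_trace, (P.isSymm_comb x).eq]
  rw [NearCentralPath, hy, and_iff_right Matrix.PosDef.one]
  change g ⬝ᵥ x ≤ _ ↔ _
  refine ⟨fun h v => ?_, fun h => ?_⟩
  · have hnorm : ‖P.comb x‖ ≤ ε := le_of_sq_le_sq (hgx ▸ h) hε
    rw [hg]
    exact (abs_trace_mul_le _ _).trans (by gcongr)
  · have h := (le_abs_self _).trans (h x)
    rw [hgx] at h ⊢
    nlinarith [norm_nonneg (P.comb x)]

end SDPData

end HessianNorm

section NewtonStep

open scoped Matrix.Norms.Frobenius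

lemma le_inv_one_add {a : ℝ} (ha : |a| ≤ 1 / 100) : 100 / 101 ≤ (1 + a)⁻¹ := by
  rw [abs_le] at ha
  rw [le_inv_comm₀ (by norm_num) (by linarith)]
  linarith

lemma abs_one_sub_inv_mul_inv_le {a b : ℝ} (ha : |a| ≤ 1 / 100) (hb : |b| ≤ 1 / 100) :
    |1 - (1 + a)⁻¹ * (1 + b)⁻¹| ≤ 21 / 1000 := by
  rw [abs_le] at ha hb
  have ha' : 0 < 1 + a := by linarith
  have hb' : 0 < 1 + b := by linarith
  have h : 1 - (1 + a)⁻¹ * (1 + b)⁻¹ = ((1 + a) * (1 + b) - 1) / ((1 + a) * (1 + b)) := by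
    field_simp
  rw [h, abs_div, abs_of_pos (mul_pos ha' hb'), div_le_iff₀ (mul_pos ha' hb'), abs_le]
  constructor <;> nlinarith

lemma inv_one_add_diagonal {ι : Type*} [Fintype ι] [DecidableEq ι] {mu : ι → ℝ}
    (h : ∀ i, 1 + mu i ≠ 0) :
    (1 + Matrix.diagonal mu)⁻¹ = Matrix.diagonal fun i => (1 + mu i)⁻¹ := by
  refine Matrix.inv_eq_left_inv ?_
  rw [← Matrix.diagonal_one, Matrix.diagonal_add, Matrix.diagonal_mul_diagonal]
  simp only [inv_mul_cancel₀ (h _)]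

namespace SDPData

variable {n m : ℕ} {P : SDPData n m} {S T M : Matrix (Fin n) (Fin n) ℝ} {d : Fin n → ℝ}
  {c ε η : ℝ} {y : Fin m → ℝ}

lemma nearCentralPath_iff_of_whitens (hP : P.NoRedundantConstraints) (hε : 0 ≤ ε)
    (hT : Tᵀ * P.slack y * T = 1) :
    P.NearCentralPath ε η y ↔ ∀ v, |P.gradient η y ⬝ᵥ v| ≤ ε * ‖Tᵀ * P.comb v * T‖ := by
  have hunit := isUnit_of_whitens hT
  rw [← nearCentralPath_congr_iff hunit,
    nearCentralPath_iff_of_slack_eq_one (hP.congr hunit) hε (by rw [slack_congr, hT]),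
    gradient_congr hunit]
  simp only [comb_congr]

lemma NearCentralPath.mono {ε' : ℝ} (h : P.NearCentralPath ε η y) (hε : 0 ≤ ε) (hεε' : ε ≤ ε') :
    P.NearCentralPath ε' η y :=
  ⟨h.1, h.2.trans (by gcongr)⟩

lemma nearCentralPath_of_abs_gradient_le (hP : P.NoRedundantConstraints) (hc : 0 ≤ c)
    (hy : ‖P.slack y - 1‖ < 1) (hg : ∀ v, |P.gradient η y ⬝ᵥ v| ≤ c * ‖P.comb v‖) :
    P.NearCentralPath (c * (1 + ‖P.slack y - 1‖)) η y := by
  obtain ⟨T, hT⟩ : ∃ T, Tᵀ * P.slack y * T = 1 :=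
    ⟨_, whitens_inv_sqrt (posDef_of_frobenius_sub_one_lt (P.isSymm_slack y) hy)⟩
  refine (nearCentralPath_iff_of_whitens hP (by positivity) hT).mpr fun v => (hg v).trans ?_
  have h := frobenius_mul_mul_transpose_le (T⁻¹)ᵀ (Tᵀ * P.comb v * T)
  rw [frobenius_transpose_mul_self_sub_one, Matrix.transpose_transpose,
    inv_transpose_mul_inv_of_whitens hT, inv_congr_inv (isUnit_of_whitens hT)] at h
  rw [mul_assoc]
  gcongr

lemma nearCentralPath_of_b_eq_trace (hP : P.NoRedundantConstraints)
    (hb : ∀ j, P.b j = (P.A j).trace) (hε : ε < 1) (hy : ‖P.slack y - 1‖ ≤ ε) :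
    P.NearCentralPath ε 1 y := by
  obtain ⟨T, hT⟩ : ∃ T, Tᵀ * P.slack y * T = 1 :=
    ⟨_, whitens_inv_sqrt (posDef_of_frobenius_sub_one_lt (P.isSymm_slack y) (hy.trans_lt hε))⟩
  have hunit := isUnit_of_whitens hT
  refine (nearCentralPath_iff_of_whitens hP ((norm_nonneg _).trans hy) hT).mpr fun v => ?_
  set K := T⁻¹
  set V := Tᵀ * P.comb v * T with hV
  have hbv : P.b ⬝ᵥ v = (P.comb v).trace := by
    rw [← one_mul (P.comb v), trace_mul_comb, dotProduct]
    exact Finset.sum_congr rfl fun j _ => by rw [hb, one_mul, mul_comm]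
  have hcomb : (P.comb v).trace = (K * Kᵀ * V).trace := by
    rw [← inv_congr_inv hunit (P.comb v), ← hV, Matrix.trace_mul_cycle]
  have hinv : ((P.slack y)⁻¹ * P.comb v).trace = V.trace := by
    rw [← trace_inv_congr hunit, hT, inv_one, one_mul]
  have hg : P.gradient 1 y ⬝ᵥ v = ((K * Kᵀ - 1) * V).trace := by
    rw [gradient_dotProduct, one_mul, hbv, hcomb, hinv, sub_mul, one_mul, Matrix.trace_sub]
  have hK : ‖K * Kᵀ - 1‖ ≤ ε := by
    rwa [← frobenius_transpose_mul_self_sub_one, inv_transpose_mul_inv_of_whitens hT]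
  rw [hg]
  exact (abs_trace_mul_le _ _).trans (by gcongr)

lemma gradient_dotProduct_of_slack_eq_one (hy : P.slack y = 1) (v : Fin m → ℝ) :
    P.gradient η y ⬝ᵥ v = η * (P.b ⬝ᵥ v) - (P.comb v).trace := by
  rw [gradient_dotProduct, hy, inv_one, one_mul]

lemma abs_gradient_mul_one_add_le (hy : P.slack y = 1) {t : ℝ} (ht : 0 ≤ t) {v : Fin m → ℝ}
    (hg : |P.gradient η y ⬝ᵥ v| ≤ ε * ‖P.comb v‖) :
    |P.gradient (η * (1 + t)) y ⬝ᵥ v| ≤ ((1 + t) * ε + t * √n) * ‖P.comb v‖ := by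
  have htrace : |(P.comb v).trace| ≤ √n * ‖P.comb v‖ := by
    simpa only [one_mul, frobenius_one, Fintype.card_fin] using abs_trace_mul_le 1 (P.comb v)
  have h : P.gradient (η * (1 + t)) y ⬝ᵥ v =
      (1 + t) * (P.gradient η y ⬝ᵥ v) + t * (P.comb v).trace := by
    simp only [gradient_dotProduct_of_slack_eq_one hy]
    ring
  calc |P.gradient (η * (1 + t)) y ⬝ᵥ v|
      ≤ (1 + t) * |P.gradient η y ⬝ᵥ v| + t * |(P.comb v).trace| := by
        rw [h]
        refine (abs_add_le _ _).trans_eq ?_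
        rw [abs_mul, abs_mul, abs_of_nonneg ht, abs_of_nonneg (by linarith : 0 ≤ 1 + t)]
    _ ≤ (1 + t) * (ε * ‖P.comb v‖) + t * (√n * ‖P.comb v‖) := by gcongr
    _ = ((1 + t) * ε + t * √n) * ‖P.comb v‖ := by ring

lemma abs_gradient_increase_le (hy : P.slack y = 1) (hn : 1 ≤ n) (hε : 0 < ε) (hε' : ε ≤ 1 / 10)
    {v : Fin m → ℝ} (hg : |P.gradient η y ⬝ᵥ v| ≤ ε * ‖P.comb v‖) :
    |P.gradient (η * (1 + ε / (20 * √n))) y ⬝ᵥ v| ≤ 106 / 100 * ε * ‖P.comb v‖ := by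
  have hsqrt : 1 ≤ √(n : ℝ) := Real.one_le_sqrt.mpr (by exact_mod_cast hn)
  have ht : ε / (20 * √n) ≤ ε / 20 := by gcongr; linarith
  have ht' : ε / (20 * √n) * √n = ε / 20 := by field_simp
  refine (abs_gradient_mul_one_add_le hy (by positivity) hg).trans ?_
  gcongr
  nlinarith

lemma sq_mul_frobenius_newtonStep_le (hP : P.NoRedundantConstraints)
    (hM : M⁻¹ = Matrix.diagonal d) (hc : 0 < c) (hd : ∀ i, c ≤ d i) (hε : 0 ≤ ε) {g : Fin m → ℝ}
    (hg : ∀ v, |g ⬝ᵥ v| ≤ ε * ‖P.comb v‖) :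
    c ^ 2 * ‖P.comb ((P.hessian M)⁻¹ *ᵥ g)‖ ≤ ε := by
  set x := (P.hessian M)⁻¹ *ᵥ g with hx
  have h : c ^ 2 * ‖P.comb x‖ ^ 2 ≤ ε * ‖P.comb x‖ := by
    refine (sq_mul_frobenius_sq_le_hessian hM hc.le hd x).trans ?_
    rw [hx, hessian_mulVec_inv_mulVec hP hM hc hd, dotProduct_comm, ← hx]
    exact (le_abs_self _).trans (hg x)
  rcases (norm_nonneg (P.comb x)).eq_or_lt' with h0 | hpos
  · simpa only [h0, mul_zero] using hε
  · rw [sq ‖_‖, ← mul_assoc] at h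
    exact le_of_mul_le_mul_right h hpos

lemma gradient_newtonStep (hP : P.NoRedundantConstraints) (hM : M⁻¹ = Matrix.diagonal d)
    (hc : 0 < c) (hd : ∀ i, c ≤ d i) (hy : P.slack y = 1) {x : Fin m → ℝ}
    (hx : x = (P.hessian M)⁻¹ *ᵥ P.gradient η y) (v : Fin m → ℝ) :
    P.gradient η (y - x) ⬝ᵥ v = ((Matrix.diagonal d * P.comb x * Matrix.diagonal d + 1 -
      (P.slack (y - x))⁻¹) * P.comb v).trace := by
  have hnewton : P.gradient η y ⬝ᵥ v =
      (Matrix.diagonal d * P.comb x * Matrix.diagonal d * P.comb v).trace := by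
    rw [← hessian_mulVec_inv_mulVec hP hM hc hd (P.gradient η y), ← hx, dotProduct_comm,
      dotProduct_hessian_mulVec, hM, Matrix.mul_assoc (_ * _), Matrix.trace_mul_comm,
      ← Matrix.mul_assoc]
  rw [gradient_dotProduct_of_slack_eq_one hy, sub_eq_iff_eq_add] at hnewton
  rw [gradient_dotProduct, hnewton, sub_mul, add_mul, one_mul, Matrix.trace_sub, Matrix.trace_add]

lemma frobenius_newton_residual_le (hd : ∀ i j, |1 - d i * d j| ≤ 21 / 1000)
    {X G : Matrix (Fin n) (Fin n) ℝ} (hX : ‖X‖ ≤ 11 / 100) (hG : (1 - X) * G = 1) :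
    ‖Matrix.diagonal d * X * Matrix.diagonal d + 1 - G‖ ≤ 15 / 100 * ‖X‖ := by
  have hnorm : ‖1 - X - 1‖ = ‖X‖ := by rw [sub_sub_cancel_left, norm_neg]
  have hG_norm : ‖1 - G‖ ≤ 11 / 100 / (1 - 11 / 100) := by
    refine (norm_one_sub_le_of_mul_eq_one hG (by linarith)).trans ?_
    rw [hnorm]
    gcongr
  have hG_eq : 1 - G = X * (1 - G) - X := by
    nth_rewrite 1 [← hG]
    noncomm_ring
  have hres : Matrix.diagonal d * X * Matrix.diagonal d + 1 - G =
      X * (1 - G) - (X - Matrix.diagonal d * X * Matrix.diagonal d) := by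
    rw [add_sub_assoc]
    nth_rewrite 1 [hG_eq]
    abel
  calc ‖Matrix.diagonal d * X * Matrix.diagonal d + 1 - G‖
      ≤ ‖X‖ * (11 / 100 / (1 - 11 / 100)) + 21 / 1000 * ‖X‖ := by
        rw [hres]
        refine (norm_sub_le _ _).trans (add_le_add ((norm_mul_le _ _).trans (by gcongr)) ?_)
        exact frobenius_sub_diagonal_mul_mul_le (by norm_num) hd X
    _ ≤ 15 / 100 * ‖X‖ := by linarith [norm_nonneg X]

lemma nearCentralPath_newtonStep_of_slack_eq_one (hP : P.NoRedundantConstraints) (hn : 1 ≤ n)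
    (hε : 0 < ε) (hε' : ε ≤ 1 / 10) {mu : Fin n → ℝ} (hmu : ∀ i, |mu i| ≤ epsS)
    (hy : P.slack y = 1) (hnear : P.NearCentralPath ε η y) {η' : ℝ}
    (hη' : η' = η * (1 + ε / (20 * √n))) {y' : Fin m → ℝ}
    (hy' : y' = y - (P.hessian (1 + Matrix.diagonal mu))⁻¹ *ᵥ P.gradient η' y) :
    ‖P.slack y' - 1‖ ≤ 11 / 100 ∧ P.NearCentralPath ε η' y' := by
  set x := (P.hessian (1 + Matrix.diagonal mu))⁻¹ *ᵥ P.gradient η' y with hx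
  have hd (i : Fin n) : 100 / 101 ≤ (1 + mu i)⁻¹ := le_inv_one_add (hmu i)
  have hM := inv_one_add_diagonal (mu := mu) fun i hi => by
    have := hd i
    rw [hi, inv_zero] at this
    linarith
  have hslack : P.slack y' - 1 = -P.comb x := by rw [hy', slack_sub, hy, sub_sub_cancel_left]
  have hgrad (v) := abs_gradient_increase_le hy hn hε hε' (η := η)
    ((nearCentralPath_iff_of_slack_eq_one hP hε.le hy).mp hnear v)
  rw [← hη'] at hgrad
  have hX := sq_mul_frobenius_newtonStep_le hP hM (by norm_num) hd (by positivity) hgrad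
  rw [← hx] at hX
  have hX_small : ‖P.comb x‖ ≤ 11 / 100 := by linarith
  have hclose : ‖P.slack y' - 1‖ ≤ 11 / 100 := by rwa [hslack, norm_neg]
  have hG : (1 - P.comb x) * (P.slack y')⁻¹ = 1 := by
    rw [← hy, ← slack_sub, ← hy', hy]
    exact Matrix.mul_nonsing_inv _ ((Matrix.isUnit_iff_isUnit_det _).mp
      (posDef_of_frobenius_sub_one_lt (P.isSymm_slack y') (by linarith)).isUnit)
  have hgrad' (v) : |P.gradient η' y' ⬝ᵥ v| ≤ 15 / 100 * ‖P.comb x‖ * ‖P.comb v‖ := by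
    rw [hy', gradient_newtonStep hP hM (by norm_num) hd hy hx, ← hy']
    refine (abs_trace_mul_le _ _).trans (mul_le_mul_of_nonneg_right ?_ (norm_nonneg _))
    exact frobenius_newton_residual_le (fun i j => abs_one_sub_inv_mul_inv_le (hmu i) (hmu j))
      hX_small hG
  refine ⟨hclose, (nearCentralPath_of_abs_gradient_le hP (by positivity) (by linarith)
    hgrad').mono (by positivity) ?_⟩
  nlinarith [norm_nonneg (P.comb x)]

lemma nearCentralPath_newtonStep (hP : P.NoRedundantConstraints) (hn : 1 ≤ n) (hε : 0 < ε)
    (hε' : ε ≤ 1 / 10) (hnear : P.NearCentralPath ε η y) (hT : Tᵀ * P.slack y * T = 1)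
    {mu : Fin n → ℝ} (hmu : ∀ i, |mu i| ≤ epsS) (hM : Tᵀ * M * T = 1 + Matrix.diagonal mu)
    {η' : ℝ} (hη' : η' = η * (1 + ε / (20 * √n))) {y' : Fin m → ℝ}
    (hy' : y' = y - (P.hessian M)⁻¹ *ᵥ P.gradient η' y) :
    ‖Tᵀ * P.slack y' * T - 1‖ ≤ 11 / 100 ∧ P.NearCentralPath ε η' y' := by
  have hunit := isUnit_of_whitens hT
  rw [← hessian_congr hunit, hM, ← gradient_congr hunit] at hy'
  rw [← nearCentralPath_congr_iff hunit] at hnear ⊢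
  rw [← slack_congr] at hT ⊢
  exact nearCentralPath_newtonStep_of_slack_eq_one (hP.congr hunit) hn hε hε' hmu hT hnear hη' hy'

end SDPData

end NewtonStep

section LorentzNorm

variable {ι : Type*} [Fintype ι] {w x y : ι → ℝ}

/-- The Lorentz (weighted `ℓ¹`) norm `max_σ ∑ i, w i * |x (σ i)|`. For antitone `w` it is the sum of
the `|x i|` in decreasing order with weights `w`. -/
def lorentzNorm (w x : ι → ℝ) : ℝ := ⨆ σ : Equiv.Perm ι, ∑ i, w i * |x (σ i)|

lemma sum_mul_le_lorentzNorm (w x : ι → ℝ) (σ : Equiv.Perm ι) :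
    ∑ i, w i * |x (σ i)| ≤ lorentzNorm w x :=
  le_ciSup (f := fun σ : Equiv.Perm ι => ∑ i, w i * |x (σ i)|) (Set.finite_range _).bddAbove σ

lemma lorentzNorm_le {c : ℝ} (h : ∀ σ : Equiv.Perm ι, ∑ i, w i * |x (σ i)| ≤ c) :
    lorentzNorm w x ≤ c :=
  ciSup_le h

lemma lorentzNorm_nonneg (hw : 0 ≤ w) (x : ι → ℝ) : 0 ≤ lorentzNorm w x :=
  (Finset.sum_nonneg fun i _ => mul_nonneg (hw i) (abs_nonneg _)).trans
    (sum_mul_le_lorentzNorm w x 1)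

@[simp]
lemma lorentzNorm_zero (w : ι → ℝ) : lorentzNorm w 0 = 0 := by
  simp [lorentzNorm]

lemma lorentzNorm_add_le (hw : 0 ≤ w) (x y : ι → ℝ) :
    lorentzNorm w (x + y) ≤ lorentzNorm w x + lorentzNorm w y := by
  refine lorentzNorm_le fun σ => le_trans ?_
    (add_le_add (sum_mul_le_lorentzNorm w x σ) (sum_mul_le_lorentzNorm w y σ))
  simp only [← Finset.sum_add_distrib, ← mul_add]
  exact Finset.sum_le_sum fun i _ => mul_le_mul_of_nonneg_left (abs_add_le _ _) (hw i)

lemma lorentzNorm_le_sqrt_mul_sqrt (w x : ι → ℝ) :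
    lorentzNorm w x ≤ √(∑ i, w i ^ 2) * √(∑ i, x i ^ 2) := by
  refine lorentzNorm_le fun σ => (Real.sum_mul_le_sqrt_mul_sqrt _ _ _).trans_eq ?_
  simp only [sq_abs]
  rw [Equiv.sum_comp σ fun i => x i ^ 2]

variable [DecidableEq ι]

lemma lorentzNorm_mulVec_le (hw : 0 ≤ w) {D : Matrix ι ι ℝ} (hD : D ∈ doublyStochastic ℝ ι)
    (x : ι → ℝ) : lorentzNorm w (D *ᵥ x) ≤ lorentzNorm w x := by
  obtain ⟨c, hc, hc_sum, rfl⟩ := exists_eq_sum_perm_of_mem_doublyStochastic hD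
  refine lorentzNorm_le fun σ => ?_
  calc ∑ i, w i * |((∑ τ, c τ • τ.permMatrix ℝ) *ᵥ x) (σ i)|
      ≤ ∑ i, w i * ∑ τ, c τ * |x (τ (σ i))| := by
        refine Finset.sum_le_sum fun i _ => mul_le_mul_of_nonneg_left ?_ (hw i)
        simp only [Matrix.sum_mulVec, Matrix.smul_mulVec, Matrix.permMatrix_mulVec,
          Finset.sum_apply, Pi.smul_apply, Function.comp_apply, smul_eq_mul]
        refine (Finset.abs_sum_le_sum_abs _ _).trans_eq ?_
        simp only [abs_mul, abs_of_nonneg (hc _)]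
    _ = ∑ τ, c τ * ∑ i, w i * |x ((σ.trans τ) i)| := by
        simp only [Finset.mul_sum, Equiv.trans_apply]
        rw [Finset.sum_comm]
        simp only [mul_left_comm]
    _ ≤ ∑ τ, c τ * lorentzNorm w x :=
        Finset.sum_le_sum fun τ _ =>
          mul_le_mul_of_nonneg_left (sum_mul_le_lorentzNorm w x _) (hc τ)
    _ = lorentzNorm w x := by rw [← Finset.sum_mul, hc_sum, one_mul]

lemma orthogonal_sq_mem_doublyStochastic {W : Matrix ι ι ℝ} (hW : W ∈ Matrix.orthogonalGroup ι ℝ) :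
    (Matrix.of fun i j => W i j ^ 2) ∈ doublyStochastic ℝ ι := by
  refine mem_doublyStochastic_iff_sum.mpr ⟨fun i j => sq_nonneg _, fun i => ?_, fun j => ?_⟩
  · simpa [Matrix.mul_apply, sq] using
      congrFun (congrFun ((Matrix.mem_orthogonalGroup_iff _ _).mp hW) i) i
  · simpa [Matrix.mul_apply, sq] using
      congrFun (congrFun ((Matrix.mem_orthogonalGroup_iff' _ _).mp hW) j) j

lemma lorentzNorm_diag_conj_le (hw : 0 ≤ w) {W : Matrix ι ι ℝ}
    (hW : W ∈ Matrix.orthogonalGroup ι ℝ) (x : ι → ℝ) :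
    lorentzNorm w (W * Matrix.diagonal x * Wᵀ).diag ≤ lorentzNorm w x := by
  refine (congrArg (lorentzNorm w) (funext fun i => ?_)).trans_le
    (lorentzNorm_mulVec_le hw (orthogonal_sq_mem_doublyStochastic hW) x)
  rw [Matrix.diag_apply, Matrix.mul_apply]
  simp only [Matrix.mul_diagonal, Matrix.mulVec, dotProduct, Matrix.transpose_apply,
    Matrix.of_apply]
  exact Finset.sum_congr rfl fun _ _ => by ring

open scoped Matrix.Norms.Frobenius in
lemma lorentzNorm_le_add_frobenius (hw : 0 ≤ w) {W : Matrix ι ι ℝ}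
    (hW : W ∈ Matrix.orthogonalGroup ι ℝ) (x y : ι → ℝ) :
    lorentzNorm w x ≤ lorentzNorm w y +
      √(∑ i, w i ^ 2) * ‖Matrix.diagonal x - W * Matrix.diagonal y * Wᵀ‖ := by
  set F := Matrix.diagonal x - W * Matrix.diagonal y * Wᵀ with hF
  have hx : x = (W * Matrix.diagonal y * Wᵀ).diag + F.diag := by
    rw [← Matrix.diag_add, hF, add_sub_cancel, Matrix.diag_diagonal]
  have hdiag : √(∑ i, F.diag i ^ 2) ≤ ‖F‖ := by
    rw [← Real.sqrt_sq (norm_nonneg F), frobenius_sq_eq_sum]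
    exact Real.sqrt_le_sqrt <| Finset.sum_le_sum fun i _ =>
      Finset.single_le_sum (f := fun j => F i j ^ 2) (fun _ _ => sq_nonneg _) (Finset.mem_univ i)
  calc lorentzNorm w x
      ≤ lorentzNorm w (W * Matrix.diagonal y * Wᵀ).diag + lorentzNorm w F.diag := by
        conv_lhs => rw [hx]
        exact lorentzNorm_add_le hw _ _
    _ ≤ lorentzNorm w y + √(∑ i, w i ^ 2) * ‖F‖ :=
        add_le_add (lorentzNorm_diag_conj_le hw hW y)
          ((lorentzNorm_le_sqrt_mul_sqrt _ _).trans (by gcongr))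

lemma lorentzNorm_le_of_antitone {n : ℕ} {w c x : Fin n → ℝ} (hw : Antitone w) (hw0 : 0 ≤ w)
    (hc : Antitone c) (π : Equiv.Perm (Fin n)) (hx : ∀ i, |x (π i)| ≤ c i) :
    lorentzNorm w x ≤ ∑ i, w i * c i := by
  refine lorentzNorm_le fun σ => ?_
  calc ∑ i, w i * |x (σ i)| ≤ ∑ i, w i * c ((σ.trans π.symm) i) := by
        refine Finset.sum_le_sum fun i _ => mul_le_mul_of_nonneg_left ?_ (hw0 i)
        simpa using hx (π.symm (σ i))
    _ ≤ ∑ i, w i * c i := (hw.monovary hc).sum_mul_comp_perm_le_sum_mul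

end LorentzNorm

section Potential

variable {n : ℕ}

/-- The weights `1 / √j` at the one-based positions `j = 1, …, n`. -/
def invSqrtWeight (n : ℕ) (i : Fin n) : ℝ := 1 / √((i : ℝ) + 1)

lemma invSqrtWeight_nonneg (n : ℕ) : 0 ≤ invSqrtWeight n := fun _ =>
  one_div_nonneg.mpr (Real.sqrt_nonneg _)

lemma invSqrtWeight_antitone (n : ℕ) : Antitone (invSqrtWeight n) := fun i j hij => by
  have : (i : ℝ) ≤ j := by exact_mod_cast hij
  unfold invSqrtWeight
  gcongr

lemma sum_invSqrtWeight_sq_le (n : ℕ) : ∑ i, invSqrtWeight n i ^ 2 ≤ 1 + Real.log n := by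
  have hsum : ∑ i, invSqrtWeight n i ^ 2 = (harmonic n : ℝ) := by
    simp only [invSqrtWeight]
    rw [Fin.sum_univ_eq_sum_range (fun i : ℕ => (1 / √((i : ℝ) + 1)) ^ 2) n, harmonic]
    push_cast
    refine Finset.sum_congr rfl fun i _ => ?_
    rw [div_pow, Real.sq_sqrt (by positivity), one_pow, one_div]
  exact hsum.trans_le (harmonic_le_one_add_log n)

lemma sqrt_le_sum_invSqrtWeight {r : ℕ} (hr : r ≤ n) :
    √r ≤ ∑ i ∈ Finset.univ.filter fun i : Fin n => (i : ℕ) < r, invSqrtWeight n i := by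
  have hcard : (Finset.univ.filter fun i : Fin n => (i : ℕ) < r).card = r := by
    simp [Fin.card_filter_val_lt, hr]
  calc √r = r • (1 / √r) := by rw [nsmul_eq_mul, mul_one_div, Real.div_sqrt]
    _ ≤ ∑ i ∈ Finset.univ.filter fun i : Fin n => (i : ℕ) < r, invSqrtWeight n i := by
        conv_lhs => rw [← hcard]
        refine Finset.card_nsmul_le_sum _ _ _ fun i hi => ?_
        have : (i : ℝ) + 1 ≤ r := by exact_mod_cast (Finset.mem_filter.mp hi).2
        rw [hcard, invSqrtWeight]
        gcongr

/-- The potential of the error spectrum `lam` of an approximate slack matrix: the sum of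
`|lam i| / √j` over the eigenvalues, where `j` is the position of `|lam i|` in decreasing order. -/
abbrev potential (lam : Fin n → ℝ) : ℝ := lorentzNorm (invSqrtWeight n) lam

end Potential

section Movement

open scoped Matrix.Norms.Frobenius

variable {ι : Type*} [Fintype ι] [DecidableEq ι] {w mu lam : ι → ℝ}
  {B K N T T' S M : Matrix ι ι ℝ}

lemma exists_orthogonal_mul_transpose_self {d : ι → ℝ} (hd : ∀ i, 0 < d i)
    (hK : Kᵀ * K = Matrix.diagonal d) :
    ∃ W ∈ Matrix.orthogonalGroup ι ℝ, K * Kᵀ = W * Matrix.diagonal d * Wᵀ := by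
  set E := Matrix.diagonal fun i => (√(d i))⁻¹ with hE
  have hEdE : E * Matrix.diagonal d * E = 1 := by
    simp only [hE, Matrix.diagonal_mul_diagonal, inv_mul_eq_div, Real.div_sqrt,
      mul_inv_cancel₀ (Real.sqrt_ne_zero'.mpr (hd _)), Matrix.diagonal_one]
  have hKE : (K * E)ᵀ = E * Kᵀ := by rw [Matrix.transpose_mul, hE, Matrix.diagonal_transpose]
  refine ⟨K * E, (Matrix.mem_orthogonalGroup_iff' _ _).mpr ?_, ?_⟩
  · calc (K * E)ᵀ * (K * E) = E * (Kᵀ * K) * E := by rw [hKE]; noncomm_ring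
      _ = 1 := by rw [hK, hEdE]
  · calc K * Kᵀ = K * (E * Matrix.diagonal d * E) * Kᵀ := by rw [hEdE, mul_one]
      _ = K * E * Matrix.diagonal d * (K * E)ᵀ := by rw [hKE]; noncomm_ring

lemma posDef_transpose_mul_self (hK : IsUnit K) : (Kᵀ * K).PosDef := by
  rw [← Matrix.conjTranspose_eq_transpose_of_trivial]
  exact Matrix.PosDef.conjTranspose_mul_self K (Matrix.mulVec_injective_of_isUnit hK)

lemma lorentzNorm_le_add_mul_transpose_self (hw : 0 ≤ w) (hK : IsUnit K)
    (hlam : Kᵀ * K = 1 + Matrix.diagonal lam) (mu : ι → ℝ) :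
    lorentzNorm w lam ≤ lorentzNorm w mu +
      √(∑ i, w i ^ 2) * ‖K * Kᵀ - (1 + Matrix.diagonal mu)‖ := by
  have hdiag : 1 + Matrix.diagonal lam = Matrix.diagonal (1 + lam) := by
    rw [← Matrix.diagonal_one, Matrix.diagonal_add]; rfl
  rw [hdiag] at hlam
  obtain ⟨W, hW, hKW⟩ := exists_orthogonal_mul_transpose_self
    (Matrix.posDef_diagonal_iff.mp (hlam ▸ posDef_transpose_mul_self hK)) hlam
  have hWW : Wᵀ * W = 1 := (Matrix.mem_orthogonalGroup_iff' _ _).mp hW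
  have hWW' : W * Wᵀ = 1 := (Matrix.mem_orthogonalGroup_iff _ _).mp hW
  have hconj : Matrix.diagonal lam - Wᵀ * Matrix.diagonal mu * W =
      Wᵀ * (K * Kᵀ - (1 + Matrix.diagonal mu)) * W := by
    calc Matrix.diagonal lam - Wᵀ * Matrix.diagonal mu * W
        = Wᵀ * W * (1 + Matrix.diagonal lam) * (Wᵀ * W) - Wᵀ * W
            - Wᵀ * Matrix.diagonal mu * W := by rw [hWW]; noncomm_ring
      _ = _ := by rw [hKW, hdiag]; noncomm_ring
  have hnorm := frobenius_mul_mul_transpose_le Wᵀ (K * Kᵀ - (1 + Matrix.diagonal mu))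
  rw [Matrix.transpose_transpose, hWW', sub_self, norm_zero, add_zero, one_mul, ← hconj] at hnorm
  have h := lorentzNorm_le_add_frobenius hw (Unitary.star_mem hW) lam mu
  rw [Matrix.star_eq_conjTranspose, Matrix.conjTranspose_eq_transpose_of_trivial,
    Matrix.transpose_transpose] at h
  exact h.trans (by gcongr)

lemma frobenius_sqrt_diagonal_congr_le (hmu : ∀ i, |mu i| ≤ 1 / 100) (X : Matrix ι ι ℝ) :
    ‖Matrix.diagonal (fun i => √(1 + mu i)) * X * Matrix.diagonal (fun i => √(1 + mu i))‖ ≤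
      101 / 100 * ‖X‖ := by
  have hsqrt (i : ι) : √(1 + mu i) ≤ √(101 / 100) :=
    Real.sqrt_le_sqrt (by linarith [le_abs_self (mu i), hmu i])
  refine frobenius_le_of_abs_le (by norm_num) fun i j => ?_
  rw [Matrix.mul_diagonal, Matrix.diagonal_mul, mul_right_comm, abs_mul,
    abs_of_nonneg (by positivity)]
  gcongr
  exact (mul_le_mul (hsqrt i) (hsqrt j) (by positivity) (by positivity)).trans_eq
    (Real.mul_self_sqrt (by norm_num))

lemma frobenius_mul_transpose_self_sub_one_le (hB : Bᵀ * N * B = 1) (hN : ‖N - 1‖ ≤ 11 / 100) :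
    ‖B * Bᵀ - 1‖ ≤ 11 / 89 := by
  have hinv : N * (B * Bᵀ) = 1 := by
    rw [← mul_assoc]
    exact mul_eq_one_comm.mp (by rwa [← mul_assoc])
  calc ‖B * Bᵀ - 1‖ = ‖1 - B * Bᵀ‖ := norm_sub_rev _ _
    _ ≤ ‖N - 1‖ / (1 - ‖N - 1‖) := norm_one_sub_le_of_mul_eq_one hinv (by linarith)
    _ ≤ (11 / 100) / (1 - 11 / 100) := by gcongr
    _ = 11 / 89 := by norm_num

/- With `K = (1 + diag mu)^(1/2) B` the matrix `Kᵀ K` has spectrum `1 + lam`, while `K Kᵀ`, which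
has the same spectrum, is close to `1 + diag mu`. -/
lemma lorentzNorm_le_add_of_congr (hw : 0 ≤ w) (hmu : ∀ i, |mu i| ≤ 1 / 100)
    (hN : Bᵀ * N * B = 1) (hclose : ‖N - 1‖ ≤ 11 / 100)
    (hB : Bᵀ * (1 + Matrix.diagonal mu) * B = 1 + Matrix.diagonal lam) :
    lorentzNorm w lam ≤ lorentzNorm w mu + √(∑ i, w i ^ 2) := by
  have hpos (i : ι) : 0 < 1 + mu i := by linarith [neg_abs_le (mu i), hmu i]
  set Q := Matrix.diagonal fun i => √(1 + mu i) with hQ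
  have hQQ : Q * Q = 1 + Matrix.diagonal mu := by
    simp only [hQ, Matrix.diagonal_mul_diagonal, Real.mul_self_sqrt (hpos _).le,
      ← Matrix.diagonal_one, Matrix.diagonal_add]
  have hQunit : IsUnit Q := Matrix.isUnit_diagonal.mpr <| Pi.isUnit_iff.mpr fun i =>
    (Real.sqrt_pos.mpr (hpos i)).ne'.isUnit
  have hQB : (Q * B)ᵀ = Bᵀ * Q := by rw [Matrix.transpose_mul, hQ, Matrix.diagonal_transpose]
  have hlam : (Q * B)ᵀ * (Q * B) = 1 + Matrix.diagonal lam := by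
    rw [← hB, ← hQQ, hQB]
    noncomm_ring
  have hdiff : Q * B * (Q * B)ᵀ - (1 + Matrix.diagonal mu) = Q * (B * Bᵀ - 1) * Q := by
    rw [← hQQ, hQB]
    noncomm_ring
  have hnorm : ‖Q * B * (Q * B)ᵀ - (1 + Matrix.diagonal mu)‖ ≤ 1 := by
    rw [hdiff]
    linarith [frobenius_sqrt_diagonal_congr_le hmu (B * Bᵀ - 1),
      frobenius_mul_transpose_self_sub_one_le hN hclose]
  refine (lorentzNorm_le_add_mul_transpose_self hw (hQunit.mul (isUnit_of_whitens hN))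
    hlam mu).trans ?_
  gcongr
  exact mul_le_of_le_one_right (Real.sqrt_nonneg _) hnorm

lemma lorentzNorm_le_add_of_whitens (hw : 0 ≤ w) (hmu : ∀ i, |mu i| ≤ 1 / 100) (hT : IsUnit T)
    (hclose : ‖Tᵀ * S * T - 1‖ ≤ 11 / 100) (hT' : T'ᵀ * S * T' = 1)
    (hM : Tᵀ * M * T = 1 + Matrix.diagonal mu) (hM' : T'ᵀ * M * T' = 1 + Matrix.diagonal lam) :
    lorentzNorm w lam ≤ lorentzNorm w mu + √(∑ i, w i ^ 2) := by
  have hcongr (X : Matrix ι ι ℝ) : (T⁻¹ * T')ᵀ * (Tᵀ * X * T) * (T⁻¹ * T') = T'ᵀ * X * T' := by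
    conv_rhs => rw [← inv_congr_inv hT X]
    simp only [Matrix.transpose_mul, Matrix.mul_assoc]
  exact lorentzNorm_le_add_of_congr hw hmu ((hcongr S).trans hT') hclose
    (hM ▸ (hcongr M).trans hM')

end Movement

section AbsEig

variable {n r : ℕ} {lam : Fin n → ℝ} {π : Equiv.Perm (Fin n)}

lemma epsS_pos : 0 < epsS := by norm_num [epsS]

lemma absEig_nonneg (lam : Fin n → ℝ) (π : Equiv.Perm (Fin n)) (j : ℕ) : 0 ≤ absEig lam π j := by
  unfold absEig
  split_ifs
  exacts [abs_nonneg _, le_rfl]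

lemma absEig_succ (lam : Fin n → ℝ) (π : Equiv.Perm (Fin n)) (i : Fin n) :
    absEig lam π (i + 1) = |lam (π i)| :=
  dif_pos ⟨Nat.le_add_left 1 i, i.isLt⟩

lemma absEig_of_lt (lam : Fin n → ℝ) (π : Equiv.Perm (Fin n)) {j : ℕ} (hj : n < j) :
    absEig lam π j = 0 :=
  dif_neg fun h => hj.not_ge h.2

lemma absEig_antitoneOn (hs : Antitone fun i : Fin n => |lam (π i)|) :
    AntitoneOn (absEig lam π) (Set.Ici 1) := by
  intro j (hj : 1 ≤ j) k (hk : 1 ≤ k) hjk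
  by_cases hkn : k ≤ n
  · rw [absEig, absEig, dif_pos ⟨hk, hkn⟩, dif_pos ⟨hj, hjk.trans hkn⟩]
    exact hs (Fin.mk_le_mk.mpr (by omega))
  · rw [absEig_of_lt lam π (not_le.mp hkn)]
    exact absEig_nonneg _ _ _

lemma not_loopGuard_card (hlog : 1 ≤ Real.log n) : ¬ LoopGuard lam π n := by
  have hn : n ≠ 0 := by rintro rfl; norm_num at hlog
  rw [LoopGuard, absEig_of_lt lam π (show n < 2 * n by omega), not_or, not_lt, not_lt]
  exact ⟨epsS_pos.le, mul_nonneg (sub_nonneg.mpr (div_le_one_of_le₀ hlog (by linarith)))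
    (absEig_nonneg _ _ _)⟩

/- Each passed guard means that doubling the position costs a factor of at most `1 - 1 / log n`. -/
lemma pow_mul_epsS_le_absEig (hlog : 1 ≤ Real.log n) (hs : Antitone fun i : Fin n => |lam (π i)|)
    (hbig : epsS < absEig lam π 1) (hguard : ∀ j, 1 ≤ j → j < r → LoopGuard lam π j) (k : ℕ) :
    ∀ j, 1 ≤ j → j ≤ r → j ≤ 2 ^ k → (1 - 1 / Real.log n) ^ k * epsS ≤ absEig lam π j := by
  have hq : 0 ≤ 1 - 1 / Real.log n := sub_nonneg.mpr (div_le_one_of_le₀ hlog (by linarith))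
  have hq1 : 1 - 1 / Real.log n ≤ 1 := sub_le_self _ (by positivity)
  have hpow (k : ℕ) : (1 - 1 / Real.log n) ^ k * epsS ≤ epsS :=
    mul_le_of_le_one_left epsS_pos.le (pow_le_one₀ hq hq1)
  induction k with
  | zero =>
    intro j hj _ hj2
    obtain rfl : j = 1 := le_antisymm hj2 hj
    exact (hpow 0).trans hbig.le
  | succ k ih =>
    intro j hj hjr hj2
    rcases hj.eq_or_lt with rfl | hj1
    · exact (hpow _).trans hbig.le
    · rw [pow_succ] at hj2
      set i := (j + 1) / 2
      have hi : 1 ≤ i := by omega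
      refine le_trans ?_ (absEig_antitoneOn hs hj (show 1 ≤ 2 * i by omega) (by omega))
      rcases hguard i hi (by omega) with h | h
      · exact (hpow _).trans h.le
      · rw [pow_succ', mul_assoc]
        exact (mul_le_mul_of_nonneg_left (ih i hi (by omega) (by omega)) hq).trans h.le

end AbsEig

section LogBounds

lemma neg_two_mul_le_log_one_sub {x : ℝ} (hx0 : 0 ≤ x) (hx : x ≤ 1 / 2) :
    -(2 * x) ≤ Real.log (1 - x) := by
  have hpos : 0 < 1 - x := by linarith
  refine le_trans ?_ (Real.one_sub_inv_le_log_of_pos hpos)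
  have hinv : (1 - x)⁻¹ ≤ 1 + 2 * x := by
    rw [inv_le_iff_one_le_mul₀ hpos]
    nlinarith
  linarith

lemma clog_two_le {n : ℕ} (hn : 2 ≤ Real.log n) : (Nat.clog 2 n : ℝ) ≤ 2 * Real.log n := by
  have hn1 : 1 < n := by
    by_contra h
    have : Real.log n ≤ 0 := Real.log_nonpos n.cast_nonneg (by exact_mod_cast not_lt.mp h)
    linarith
  have hclog := Nat.clog_pos one_lt_two hn1
  have hlt : 2 ^ (Nat.clog 2 n - 1) < n := Nat.pow_pred_clog_lt_self one_lt_two hn1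
  have hlog : ((Nat.clog 2 n : ℝ) - 1) * Real.log 2 ≤ Real.log n := by
    rw [← Nat.cast_pred hclog, ← Real.log_pow]
    exact Real.log_le_log (by positivity) (by exact_mod_cast hlt.le)
  nlinarith [Real.log_two_gt_d9]

lemma exp_neg_four_le_pow_clog {n : ℕ} (hn : 2 ≤ Real.log n) :
    Real.exp (-4) ≤ (1 - 1 / Real.log n) ^ Nat.clog 2 n := by
  have hx : 1 / Real.log n ≤ 1 / 2 := one_div_le_one_div_of_le two_pos hn
  have hpos : 0 < 1 - 1 / Real.log n := by linarith
  rw [← Real.le_log_iff_exp_le (pow_pos hpos _), Real.log_pow]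
  calc (-4 : ℝ) = 2 * Real.log n * -(2 * (1 / Real.log n)) := by field_simp; norm_num
    _ ≤ Nat.clog 2 n * -(2 * (1 / Real.log n)) :=
        mul_le_mul_of_nonpos_right (clog_two_le hn) (neg_nonpos.mpr (by positivity))
    _ ≤ Nat.clog 2 n * Real.log (1 - 1 / Real.log n) := by
        gcongr
        exact neg_two_mul_le_log_one_sub (by positivity) hx

end LogBounds

section Update

variable {n r : ℕ} {lam : Fin n → ℝ} {π : Equiv.Perm (Fin n)}

lemma abs_newEig_le_min (hs : Antitone fun i : Fin n => |lam (π i)|) (hr : 1 ≤ r) (i : Fin n) :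
    |newEig lam π r (π i)| ≤ min |lam (π i)| (absEig lam π (2 * r)) := by
  rw [newEig, Equiv.symm_apply_apply]
  split_ifs with hi
  · rw [abs_zero]
    exact le_min (abs_nonneg _) (absEig_nonneg _ _ _)
  · refine le_min le_rfl ?_
    rw [← absEig_succ]
    exact absEig_antitoneOn hs (show 1 ≤ 2 * r by omega) (Nat.le_add_left 1 i) (by omega)

lemma sqrt_mul_sub_add_potential_newEig_le (hs : Antitone fun i : Fin n => |lam (π i)|)
    (hr : 1 ≤ r) (hrn : r ≤ n) :
    √r * (absEig lam π r - absEig lam π (2 * r)) + potential (newEig lam π r) ≤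
      potential lam := by
  set θ := absEig lam π (2 * r)
  have hw := invSqrtWeight_nonneg n
  have hnew : potential (newEig lam π r) ≤ ∑ i, invSqrtWeight n i * min |lam (π i)| θ :=
    lorentzNorm_le_of_antitone (invSqrtWeight_antitone n) hw
      (fun i j hij => min_le_min_right _ (hs hij)) π (abs_newEig_le_min hs hr)
  have hdrop : √r * (absEig lam π r - θ) ≤
      ∑ i, invSqrtWeight n i * (|lam (π i)| - min |lam (π i)| θ) := by
    have hθ : 0 ≤ absEig lam π r - θ :=
      sub_nonneg.mpr (absEig_antitoneOn hs hr (show 1 ≤ 2 * r by omega) (by omega))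
    refine (mul_le_mul_of_nonneg_right (sqrt_le_sum_invSqrtWeight hrn) hθ).trans ?_
    rw [Finset.sum_mul]
    refine (Finset.sum_le_sum fun i hi => mul_le_mul_of_nonneg_left ?_ (hw i)).trans
      (Finset.sum_le_univ_sum_of_nonneg fun i =>
        mul_nonneg (hw i) (sub_nonneg.mpr (min_le_left _ _)))
    rw [← absEig_succ]
    exact sub_le_sub (absEig_antitoneOn hs (Nat.le_add_left 1 i) hr (Finset.mem_filter.mp hi).2)
      (min_le_right _ _)
  simp only [mul_sub, Finset.sum_sub_distrib] at hdrop ⊢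
  linarith [sum_mul_le_lorentzNorm (invSqrtWeight n) lam π]

lemma rank_diagonal_newEig_sub_le :
    (Matrix.diagonal (newEig lam π r - lam)).rank ≤ 2 * r := by
  rw [Matrix.rank_diagonal, ← Fintype.card_fin (2 * r)]
  refine Fintype.card_le_of_injective (fun k => ⟨π.symm k.1, ?_⟩) fun a b hab => ?_
  · by_contra hlt
    exact k.2 (by rw [Pi.sub_apply, newEig, if_neg (by omega), sub_self])
  · exact Subtype.ext (π.symm.injective (Fin.ext (Fin.mk.inj hab)))

lemma sqrt_le_of_isLeast_not_loopGuard (hn : 2 ≤ Real.log n)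
    (hs : Antitone fun i : Fin n => |lam (π i)|) (hbig : epsS < absEig lam π 1)
    (hr : IsLeast {r : ℕ | 1 ≤ r ∧ ¬ LoopGuard lam π r} r) :
    √r ≤ 100 * Real.exp 4 * Real.log n * (potential lam - potential (newEig lam π r)) := by
  obtain ⟨⟨hr1, hexit⟩, hmin⟩ := hr
  have hlog : 1 ≤ Real.log n := by linarith
  have hn1 : 1 ≤ n := Nat.one_le_iff_ne_zero.mpr fun h => by norm_num [h] at hn
  have hrn : r ≤ n := hmin ⟨hn1, not_loopGuard_card hlog⟩
  have hguard (j : ℕ) (hj : 1 ≤ j) (hjr : j < r) : LoopGuard lam π j := by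
    by_contra h
    exact hjr.not_ge (hmin ⟨hj, h⟩)
  have hlow : Real.exp (-4) * epsS ≤ absEig lam π r :=
    (mul_le_mul_of_nonneg_right (exp_neg_four_le_pow_clog hn) epsS_pos.le).trans
      (pow_mul_epsS_le_absEig hlog hs hbig hguard _ r hr1 le_rfl
        (hrn.trans (Nat.le_pow_clog one_lt_two n)))
  have hgap : Real.exp (-4) * epsS / Real.log n ≤ absEig lam π r - absEig lam π (2 * r) := by
    rw [LoopGuard, not_or, not_lt, not_lt] at hexit
    calc Real.exp (-4) * epsS / Real.log n ≤ absEig lam π r / Real.log n := by gcongr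
      _ = absEig lam π r - (1 - 1 / Real.log n) * absEig lam π r := by ring
      _ ≤ _ := sub_le_sub_left hexit.2 _
  have hdrop := sqrt_mul_sub_add_potential_newEig_le hs hr1 hrn
  calc √r = 100 * Real.exp 4 * Real.log n * (√r * (Real.exp (-4) * epsS / Real.log n)) := by
        rw [Real.exp_neg, epsS]
        field_simp
    _ ≤ 100 * Real.exp 4 * Real.log n * (√r * (absEig lam π r - absEig lam π (2 * r))) := by
        gcongr
    _ ≤ 100 * Real.exp 4 * Real.log n * (potential lam - potential (newEig lam π r)) := by
        gcongr
        linarith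

end Update

section ErrorSpectrum

variable {n : ℕ} {S St St' U : Matrix (Fin n) (Fin n) ℝ} {lam mu : Fin n → ℝ}

/-- `mu` lists the eigenvalues of `S^(-1/2) M S^(-1/2) - 1`, the relative error of `M` as an
approximation of `S`. Any congruence `T` that takes `S` to the identity may replace `S^(-1/2)`. -/
def IsErrorSpectrum (S M : Matrix (Fin n) (Fin n) ℝ) (mu : Fin n → ℝ) : Prop :=
  ∃ T : Matrix (Fin n) (Fin n) ℝ, Tᵀ * S * T = 1 ∧ Tᵀ * M * T = 1 + Matrix.diagonal mu

lemma isErrorSpectrum_self (hS : S.PosDef) : IsErrorSpectrum S S 0 :=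
  ⟨(CFC.sqrt S)⁻¹, whitens_inv_sqrt hS, by
    rw [whitens_inv_sqrt hS, Matrix.diagonal_zero', add_zero]⟩

lemma isErrorSpectrum_of_inv_sqrt_conj (hS : S.PosDef) (hU : U ∈ Matrix.orthogonalGroup (Fin n) ℝ)
    (hSt : (CFC.sqrt S)⁻¹ * St * (CFC.sqrt S)⁻¹ - 1 = U * Matrix.diagonal lam * Uᵀ) :
    IsErrorSpectrum S St lam := by
  have hUU : Uᵀ * U = 1 := (Matrix.mem_orthogonalGroup_iff' _ _).mp hU
  have hsymm : ((CFC.sqrt S)⁻¹)ᵀ = (CFC.sqrt S)⁻¹ := by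
    rw [Matrix.transpose_nonsing_inv, isSymm_sqrt S]
  have hconj (X : Matrix (Fin n) (Fin n) ℝ) : ((CFC.sqrt S)⁻¹ * U)ᵀ * X * ((CFC.sqrt S)⁻¹ * U) =
      Uᵀ * (((CFC.sqrt S)⁻¹)ᵀ * X * (CFC.sqrt S)⁻¹) * U := by
    simp only [Matrix.transpose_mul, Matrix.mul_assoc]
  refine ⟨(CFC.sqrt S)⁻¹ * U, by rw [hconj, whitens_inv_sqrt hS, mul_one, hUU], ?_⟩
  calc _ = Uᵀ * (1 + U * Matrix.diagonal lam * Uᵀ) * U := by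
        rw [hconj, hsymm, ← hSt, add_sub_cancel]
    _ = Uᵀ * U + (Uᵀ * U) * Matrix.diagonal lam * (Uᵀ * U) := by noncomm_ring
    _ = 1 + Matrix.diagonal lam := by rw [hUU, one_mul, mul_one]

lemma sqrt_rank_mul_diagonal_newEig_sub_mul_le (π : Equiv.Perm (Fin n)) (lam : Fin n → ℝ) (r : ℕ)
    (X Y : Matrix (Fin n) (Fin n) ℝ) :
    √((X * Matrix.diagonal (newEig lam π r - lam) * Y).rank : ℝ) ≤ 2 * √r := by
  have hrank : (X * Matrix.diagonal (newEig lam π r - lam) * Y).rank ≤ 2 * r :=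
    (Matrix.rank_mul_le_left _ _).trans <|
      (Matrix.rank_mul_le_right _ _).trans rank_diagonal_newEig_sub_le
  calc √((X * Matrix.diagonal (newEig lam π r - lam) * Y).rank : ℝ) ≤ √((2 * r : ℕ) : ℝ) := by
        gcongr
    _ = √2 * √r := by rw [Nat.cast_mul, Nat.cast_two, Real.sqrt_mul two_pos.le]
    _ ≤ 2 * √r := by
        gcongr
        exact Real.sqrt_le_iff.mpr (by norm_num)

lemma IsApproxSlackUpdate.exists_errorSpectrum (hn : 2 ≤ Real.log n) (hS : S.PosDef)
    (h : IsApproxSlackUpdate S St St') :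
    ∃ lam lam', IsErrorSpectrum S St lam ∧ IsErrorSpectrum S St' lam' ∧ (∀ i, |lam' i| ≤ epsS) ∧
      √((St' - St).rank : ℝ) ≤
        200 * Real.exp 4 * Real.log n * (potential lam - potential lam') := by
  obtain ⟨U, hU, lam, π, hSt, hsort, ⟨hsmall, rfl⟩ | ⟨hbig, r, hr, rfl⟩⟩ := h
  · have hlam := isErrorSpectrum_of_inv_sqrt_conj hS hU hSt
    refine ⟨lam, lam, hlam, hlam, fun i => ?_, by simp⟩
    rw [← π.apply_symm_apply i, ← absEig_succ]
    exact (absEig_antitoneOn hsort (Set.mem_Ici.mpr le_rfl) (Nat.le_add_left 1 _)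
      (Nat.le_add_left 1 _)).trans hsmall
  · have hdet := isUnit_det_sqrt hS
    refine ⟨lam, newEig lam π r, isErrorSpectrum_of_inv_sqrt_conj hS hU hSt,
      isErrorSpectrum_of_inv_sqrt_conj hS hU ?_, fun i => ?_, ?_⟩
    · set Q := CFC.sqrt S
      set D := Matrix.diagonal (newEig lam π r - lam) with hD
      calc Q⁻¹ * (St + Q * U * D * Uᵀ * Q) * Q⁻¹ - 1
          = (Q⁻¹ * St * Q⁻¹ - 1) + (Q⁻¹ * Q) * (U * D * Uᵀ) * (Q * Q⁻¹) := by noncomm_ring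
        _ = U * (Matrix.diagonal lam + D) * Uᵀ := by
            rw [hSt, Matrix.nonsing_inv_mul _ hdet, Matrix.mul_nonsing_inv _ hdet]
            noncomm_ring
        _ = U * Matrix.diagonal (newEig lam π r) * Uᵀ := by
            rw [hD, Matrix.diagonal_add]
            simp only [Pi.sub_apply, add_sub_cancel]
    · rw [← π.apply_symm_apply i]
      exact (abs_newEig_le_min hsort hr.1.1 _).trans
        ((min_le_right _ _).trans (not_lt.mp (not_or.mp hr.1.2).1))
    · rw [add_sub_cancel_left, Matrix.mul_assoc _ Uᵀ]
      linarith [sqrt_le_of_isLeast_not_loopGuard hn hsort hbig hr,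
        sqrt_rank_mul_diagonal_newEig_sub_mul_le π lam r
          (CFC.sqrt S * U) (Uᵀ * CFC.sqrt S)]

end ErrorSpectrum

section Run

variable {n m : ℕ} {P : SDPData n m} {εN δ η₀ : ℝ} {y₀ : Fin m → ℝ}

/-- The invariant of the interior point method: the iterate is near the central path, and `mu` is
the spectrum of the relative error of the approximate slack matrix, with entries at most `ε_S`. -/
structure IPMInvariant (P : SDPData n m) (εN : ℝ) (s : IPMState n m) (mu : Fin n → ℝ) : Prop where
  near : P.NearCentralPath εN s.η s.y
  spectrum : IsErrorSpectrum (P.slack s.y) s.St mu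
  small : ∀ i, |mu i| ≤ epsS

lemma IPMStep.exists_invariant (hn : 2 ≤ Real.log n) (hP : P.NoRedundantConstraints) (hε : 0 < εN)
    (hε' : εN ≤ 1 / 10) {s s' : IPMState n m} (hs : IPMStep P εN s s') {mu : Fin n → ℝ}
    (hinv : IPMInvariant P εN s mu) :
    ∃ mu', IPMInvariant P εN s' mu' ∧ √((s'.St - s.St).rank : ℝ) ≤
      200 * Real.exp 4 * Real.log n * (potential mu + √(1 + Real.log n) - potential mu') := by
  have hn1 : 1 ≤ n := Nat.one_le_iff_ne_zero.mpr fun h => by norm_num [h] at hn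
  obtain ⟨T, hT, hM⟩ := hinv.spectrum
  obtain ⟨hclose, hnear⟩ := SDPData.nearCentralPath_newtonStep hP hn1 hε hε' hinv.near hT
    hinv.small hM hs.eta_new hs.y_new
  obtain ⟨lam, mu', ⟨T', hT', hM'⟩, hspec, hsmall, hrank⟩ :=
    hs.St_new.exists_errorSpectrum hn hnear.1
  refine ⟨mu', ⟨hnear, hspec, hsmall⟩, hrank.trans ?_⟩
  have hmove : potential lam ≤ potential mu + √(1 + Real.log n) :=
    (lorentzNorm_le_add_of_whitens (invSqrtWeight_nonneg n) hinv.small (isUnit_of_whitens hT)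
      hclose hT' hM hM').trans (by gcongr; exact sum_invSqrtWeight_sq_le n)
  gcongr

lemma IsIPMRun.exists_invariant (hn : 2 ≤ Real.log n) (hP : P.NoRedundantConstraints)
    (hε : 0 < εN) (hε' : εN ≤ 1 / 10) (hnear : P.NearCentralPath εN η₀ y₀)
    {s : ℕ → IPMState n m} (hs : IsIPMRun P δ εN η₀ y₀ s) :
    ∀ t ≤ numIterations n δ εN, ∃ mu, IPMInvariant P εN (s t) mu ∧
      ∑ i ∈ Finset.range t, √(updateRank s (i + 1) : ℝ) ≤
        200 * Real.exp 4 * Real.log n * (t * √(1 + Real.log n) - potential mu) := by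
  intro t
  induction t with
  | zero =>
    refine fun _ => ⟨0, ⟨?_, ?_, fun _ => ?_⟩, by simp⟩
    · rwa [hs.eta_init, hs.y_init]
    · rw [hs.y_init, hs.St_init]
      exact isErrorSpectrum_self hnear.1
    · simpa using epsS_pos.le
  | succ t ih =>
    intro ht
    obtain ⟨mu, hinv, hsum⟩ := ih (by omega)
    obtain ⟨mu', hinv', hrank⟩ := (hs.step t ht).exists_invariant hn hP hε hε' hinv
    refine ⟨mu', hinv', ?_⟩
    rw [Finset.sum_range_succ]
    calc _ ≤ _ := add_le_add hsum hrank
      _ = _ := by push_cast; ring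

lemma IsIPMRun.sum_sqrt_updateRank_le (hn : 2 ≤ Real.log n) (hP : P.NoRedundantConstraints)
    (hε : 0 < εN) (hε' : εN ≤ 1 / 10) (hnear : P.NearCentralPath εN η₀ y₀)
    {s : ℕ → IPMState n m} (hs : IsIPMRun P δ εN η₀ y₀ s) :
    ∑ i ∈ Finset.range (numIterations n δ εN), √(updateRank s (i + 1) : ℝ) ≤
      200 * Real.exp 4 * Real.log n * (numIterations n δ εN * √(1 + Real.log n)) := by
  obtain ⟨mu, -, hsum⟩ := hs.exists_invariant hn hP hε hε' hnear _ le_rfl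
  refine hsum.trans ?_
  gcongr
  exact sub_le_self _ (lorentzNorm_nonneg (invSqrtWeight_nonneg n) mu)

lemma updateRank_le (s : ℕ → IPMState n m) (i : ℕ) : updateRank s i ≤ n := by
  cases i with
  | zero => exact le_rfl
  | succ i => exact Matrix.rank_le_width _

lemma sqrt_le_numIterations (hn : 2 ≤ n) (hδ : 0 < δ) (hδ' : δ ≤ 1) (hε : 0 < εN)
    (hε' : εN ≤ 1 / 10) : √n ≤ numIterations n δ εN := by
  have hn' : (2 : ℝ) ≤ n := by exact_mod_cast hn
  have hcoef : 400 ≤ 40 / εN := by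
    rw [le_div_iff₀ hε]
    linarith
  have hlog : 1 / 2 ≤ Real.log (n / δ) := by
    have h : 2 ≤ (n : ℝ) / δ := hn'.trans (le_div_self (by positivity) hδ hδ')
    linarith [Real.log_le_log two_pos h, Real.log_two_gt_d9]
  calc √n ≤ 400 * √n * (1 / 2) := by linarith [Real.sqrt_nonneg (n : ℝ)]
    _ ≤ 40 / εN * √n * Real.log (n / δ) := by gcongr
    _ ≤ numIterations n δ εN := Nat.le_ceil _

lemma rpow_three_halves {x : ℝ} (hx : 0 ≤ x) : x ^ (3 / 2 : ℝ) = x * √x := by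
  rw [show (3 / 2 : ℝ) = 1 + 1 / 2 by norm_num, Real.rpow_add' hx (by norm_num), Real.rpow_one,
    Real.sqrt_eq_rpow]

lemma half_le_log_rpow_three_halves (hn : 2 ≤ n) : 1 / 2 ≤ Real.log n ^ (3 / 2 : ℝ) := by
  have hlog : 64 / 100 ≤ Real.log n := by
    have hmono : Real.log 2 ≤ Real.log n := Real.log_le_log two_pos (by exact_mod_cast hn)
    linarith [Real.log_two_gt_d9]
  have hsqrt : 8 / 10 ≤ √(Real.log n) := Real.le_sqrt_of_sq_le (by linarith)
  rw [rpow_three_halves (by linarith)]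
  nlinarith

lemma le_eight_of_log_lt_two (hn : Real.log n < 2) : n ≤ 8 := by
  by_contra! h
  have hlog : Real.log ((2 : ℝ) ^ 3) ≤ Real.log n :=
    Real.log_le_log (by norm_num) (by exact_mod_cast h.le)
  rw [Real.log_pow] at hlog
  push_cast at hlog
  linarith [Real.log_two_gt_d9]

lemma IsIPMRun.sum_sqrt_updateRank_le_of_two_le_log (hn : 2 ≤ Real.log n)
    (hP : P.NoRedundantConstraints) (hε : 0 < εN) (hε' : εN ≤ 1 / 10)
    (hnear : P.NearCentralPath εN η₀ y₀) {s : ℕ → IPMState n m}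
    (hs : IsIPMRun P δ εN η₀ y₀ s) :
    ∑ i ∈ Finset.range (numIterations n δ εN), √(updateRank s (i + 1) : ℝ) ≤
      400 * Real.exp 4 * (numIterations n δ εN * Real.log n ^ (3 / 2 : ℝ)) := by
  refine (hs.sum_sqrt_updateRank_le hn hP hε hε' hnear).trans ?_
  have hsqrt : √(1 + Real.log n) ≤ 2 * √(Real.log n) := by
    rw [Real.sqrt_le_left (by positivity), mul_pow, Real.sq_sqrt (by linarith)]
    linarith
  calc 200 * Real.exp 4 * Real.log n * (numIterations n δ εN * √(1 + Real.log n))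
      ≤ 200 * Real.exp 4 * Real.log n * (numIterations n δ εN * (2 * √(Real.log n))) := by gcongr
    _ = _ := by rw [rpow_three_halves (by linarith)]; ring

theorem IsIPMRun.rank_inequality (hn : 2 ≤ n) (hP : P.NoRedundantConstraints) (hδ : 0 < δ)
    (hδ' : δ ≤ 1) (hε : 0 < εN) (hε' : εN ≤ 1 / 10) (hnear : P.NearCentralPath εN η₀ y₀)
    {s : ℕ → IPMState n m} (hs : IsIPMRun P δ εN η₀ y₀ s) :
    ∑ i ∈ Finset.range (numIterations n δ εN + 1), √(updateRank s i : ℝ) ≤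
      (400 * Real.exp 4 + 8) * (numIterations n δ εN * Real.log n ^ (3 / 2 : ℝ)) := by
  have hfirst := sqrt_le_numIterations hn hδ hδ' hε hε'
  set T := numIterations n δ εN
  have hT : (T : ℝ) * (1 / 2) ≤ T * Real.log n ^ (3 / 2 : ℝ) := by
    gcongr
    exact half_le_log_rpow_three_halves hn
  rw [Finset.sum_range_succ']
  have hzero : √(updateRank s 0 : ℝ) ≤ T := hfirst
  rcases le_or_gt 2 (Real.log n) with hlog | hlog
  · have hrest := hs.sum_sqrt_updateRank_le_of_two_le_log hlog hP hε hε' hnear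
    linarith [Nat.cast_nonneg (α := ℝ) T]
  · have hrank (i : ℕ) : √(updateRank s (i + 1) : ℝ) ≤ 3 := by
      have h : (updateRank s (i + 1) : ℝ) ≤ 8 := by
        exact_mod_cast (updateRank_le s (i + 1)).trans (le_eight_of_log_lt_two hlog)
      exact Real.sqrt_le_iff.mpr ⟨by norm_num, by linarith⟩
    have hrest := Finset.sum_le_card_nsmul (Finset.range T) _ 3 fun i _ => hrank i
    rw [Finset.card_range, nsmul_eq_mul] at hrest
    have hexp : 0 ≤ 400 * Real.exp 4 * (T * Real.log n ^ (3 / 2 : ℝ)) := by positivity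
    linarith

end Run

section BlockDiag

open scoped Matrix.Norms.Frobenius

variable {n : ℕ}

lemma blockDiag_castAdd (M : Matrix (Fin n) (Fin n) ℝ) (u v : ℝ) (i j : Fin n) :
    blockDiag M u v (Fin.castAdd 2 i) (Fin.castAdd 2 j) = M i j := by
  simp [blockDiag]

lemma blockDiag_natAdd (M : Matrix (Fin n) (Fin n) ℝ) (u v : ℝ) (i j : Fin 2) :
    blockDiag M u v (Fin.natAdd n i) (Fin.natAdd n j) = Matrix.diagonal ![u, v] i j := by
  simp [blockDiag]

lemma blockDiag_one : blockDiag (1 : Matrix (Fin n) (Fin n) ℝ) 1 1 = 1 := by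
  have h : Matrix.diagonal ![(1 : ℝ), 1] = 1 := by
    rw [← Matrix.diagonal_one]
    congr 1
    ext i
    fin_cases i <;> rfl
  simp [blockDiag, h, Matrix.fromBlocks_one]

lemma blockDiag_sub (M M' : Matrix (Fin n) (Fin n) ℝ) (u u' v v' : ℝ) :
    blockDiag M u v - blockDiag M' u' v' = blockDiag (M - M') (u - u') (v - v') := by
  ext i j
  induction i using Fin.addCases <;> induction j using Fin.addCases
  case right.right i j => fin_cases i <;> fin_cases j <;> simp [blockDiag]
  all_goals simp [blockDiag]

lemma trace_blockDiag (M : Matrix (Fin n) (Fin n) ℝ) (u v : ℝ) :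
    (blockDiag M u v).trace = M.trace + (u + v) := by
  rw [Matrix.trace, Fin.sum_univ_add]
  simp [blockDiag_castAdd, blockDiag_natAdd, Matrix.trace]

lemma frobenius_blockDiag_zero (M : Matrix (Fin n) (Fin n) ℝ) : ‖blockDiag M 0 0‖ = ‖M‖ := by
  refine (sq_eq_sq₀ (norm_nonneg _) (norm_nonneg _)).mp ?_
  simp [frobenius_sq_eq_sum, Fin.sum_univ_add, blockDiag]

lemma frobenius_le_sqrt_mul_opNorm (M : Matrix (Fin n) (Fin n) ℝ) :
    ‖M‖ ≤ √n * ‖Matrix.toEuclideanCLM (𝕜 := ℝ) M‖ := by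
  have hcol (j : Fin n) : ∑ i, M i j ^ 2 ≤ ‖Matrix.toEuclideanCLM (𝕜 := ℝ) M‖ ^ 2 := by
    have h := (Matrix.toEuclideanCLM (𝕜 := ℝ) M).le_opNorm (EuclideanSpace.single j 1)
    rw [PiLp.norm_single, norm_one, mul_one] at h
    refine le_of_eq_of_le ?_ (pow_le_pow_left₀ (norm_nonneg _) h 2)
    rw [EuclideanSpace.norm_sq_eq, EuclideanSpace.single, Matrix.toEuclideanCLM_toLp]
    simp
  refine le_of_sq_le_sq ?_ (by positivity)
  rw [mul_pow, Real.sq_sqrt n.cast_nonneg, frobenius_sq_eq_sum, Finset.sum_comm]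
  exact (Finset.sum_le_sum fun j _ => hcol j).trans_eq (by simp)

end BlockDiag

namespace SDPData

variable {n m : ℕ} {P : SDPData n m} {δ L εN : ℝ}

lemma NoRedundantConstraints.modified (hP : P.NoRedundantConstraints) (δ R L : ℝ) :
    (P.modified δ R L).NoRedundantConstraints := by
  rw [NoRedundantConstraints, Fintype.linearIndependent_iff]
  intro g hg
  simp only [Fin.sum_univ_castSucc, SDPData.modified, Fin.snoc_castSucc, Fin.snoc_last] at hg
  have hlast : g (Fin.last m) = 0 := by
    simpa [Matrix.sum_apply, blockDiag_natAdd] using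
      congrFun (congrFun hg (Fin.natAdd n 0)) (Fin.natAdd n 0)
  have hinit : ∑ i : Fin m, g i.castSucc • P.A i = 0 := by
    ext i j
    simpa [Matrix.sum_apply, blockDiag_castAdd, hlast] using
      congrFun (congrFun hg (Fin.castAdd 2 i)) (Fin.castAdd 2 j)
  exact Fin.lastCases hlast (Fintype.linearIndependent_iff.mp hP _ hinit)

lemma modified_slack_sub_one (P : SDPData n m) (δ R L : ℝ) :
    (P.modified δ R L).slack (modifiedStart m) - 1 = blockDiag (-((δ / L) • P.C)) 0 0 := by
  have hslack : (P.modified δ R L).slack (modifiedStart m) =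
      blockDiag 1 1 0 - blockDiag ((δ / L) • P.C) 0 (-1) := by
    rw [slack, Fin.sum_univ_castSucc]
    simp [SDPData.modified, modifiedStart]
  rw [hslack, ← blockDiag_one, blockDiag_sub, blockDiag_sub]
  congr 1
  · abel
  · ring
  · ring

lemma modified_b_eq_trace (P : SDPData n m) (δ R L : ℝ) (j : Fin (m + 1)) :
    (P.modified δ R L).b j = ((P.modified δ R L).A j).trace := by
  refine Fin.lastCases ?_ (fun i => ?_) j <;> simp [SDPData.modified, trace_blockDiag]

open scoped Matrix.Norms.Frobenius in
lemma nearCentralPath_modifiedStart (hP : P.NoRedundantConstraints) (R : ℝ) (hL : 0 < L)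
    (hC : ‖Matrix.toEuclideanCLM (𝕜 := ℝ) P.C‖ ≤ L) (hδ : 0 ≤ δ) (hδε : δ * √n ≤ εN)
    (hε : εN < 1) : (P.modified δ R L).NearCentralPath εN 1 (modifiedStart m) := by
  refine nearCentralPath_of_b_eq_trace (hP.modified δ R L) (P.modified_b_eq_trace δ R L) hε ?_
  rw [modified_slack_sub_one, frobenius_blockDiag_zero, norm_neg, norm_smul, Real.norm_eq_abs,
    abs_of_nonneg (div_nonneg hδ hL.le)]
  calc δ / L * ‖P.C‖ ≤ δ / L * (√n * L) := by
        gcongr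
        exact (frobenius_le_sqrt_mul_opNorm P.C).trans (by gcongr)
    _ = δ * √n := by field_simp
    _ ≤ εN := hδε

end SDPData

end

theorem theorem6p1 :
    ∃ K : ℝ, 0 < K ∧
      -- runs on an arbitrary program from an arbitrary start near the central path
      (∀ (n m : ℕ) (P : SDPData n m) (δ εN η₀ : ℝ) (y₀ : Fin m → ℝ) (s : ℕ → IPMState n m),
        2 ≤ n → P.NoRedundantConstraints →
        0 < δ → δ ≤ 1 / 10 → 0 < εN → εN ≤ 1 / 10 → 0 < η₀ →
        P.NearCentralPath εN η₀ y₀ →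
        IsIPMRun P δ εN η₀ y₀ s →
        ∑ i ∈ Finset.range (numIterations n δ εN + 1), √(updateRank s i : ℝ) ≤
          K * (numIterations n δ εN * Real.log n ^ (3 / 2 : ℝ))) ∧
      -- runs on the modified program from its explicit initial solution
      (∀ (n m : ℕ) (P : SDPData n m) (δ εN R L : ℝ) (s : ℕ → IPMState (n + 2) (m + 1)),
        P.NoRedundantConstraints →
        0 < R → 0 < L → ‖Matrix.toEuclideanCLM (𝕜 := ℝ) P.C‖ ≤ L →
        0 < δ → δ ≤ 1 / 10 → 0 < εN → εN ≤ 1 / 10 → δ * √(n : ℝ) ≤ εN →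
        IsIPMRun (P.modified δ R L) δ εN 1 (modifiedStart m) s →
        ∑ i ∈ Finset.range (numIterations (n + 2) δ εN + 1), √(updateRank s i : ℝ) ≤
          K * (numIterations (n + 2) δ εN * Real.log (n + 2) ^ (3 / 2 : ℝ))) := by
  refine ⟨400 * Real.exp 4 + 8, by positivity, ?_, ?_⟩
  · intro n m P δ εN η₀ y₀ s hn hP hδ hδ1 hε hε1 _ hnear hs
    exact hs.rank_inequality hn hP hδ (by linarith) hε hε1 hnear
  · intro n m P δ εN R L s hP _ hL hC hδ hδ1 hε hε1 hδε hs
    have hnear := SDPData.nearCentralPath_modifiedStart hP R hL hC hδ.le hδε (by linarith)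
    have h := hs.rank_inequality (by omega) (hP.modified δ R L) hδ (by linarith) hε hε1 hnear
    push_cast at h
    exact h
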